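/- Let $n\in\mathbb N$. For a partition $\lambda$ of length at most $n$ let $s_\lambda\in\mathbb Z[x_1,\dots,x_n]$ be the Schur polynomial, i.e. the sum of the monomials $x^T$ over all semistandard Young tableaux $T$ of shape $\lambda$ with entries in $\{1,\dots,n\}$. A polynomial in $\mathbb Z[x_1,\dots,x_n]$ is called Schur positive if it is a linear combination of such $s_\lambda$ with coefficients in $\mathbb N$. Let $\mathrm{Schur}_n$ be the semiring of Schur positive polynomials, preordered by $p\le q$ if and only if $q-p$ is Schur positive, and let $\mathbb{TR}_+=(\mathbb R\cup\{-\infty\},\max,+)$ be the semiring of tropical reals with the usual order. A homomorphism of semirings $\psi:\mathrm{Schur}_n\to\mathbb{TR}_+$ (it preserves $0$, $1$, sums and products, so that $\psi(0)=-\infty$ and $\psi(1)$ is the real number $0$) has trivial kernel if $\psi(p)=-\infty$ only for $p=0$. **Proposition 3.3.** The monotone semiring homomorphisms $\mathrm{Schur}_n\to\mathbb{TR}_+$ with trivial kernel are exactly the maps $$\psi_y:\ \sum_{\alpha\in\mathbb N^n}p_\alpha x^\alpha\ \longmapsto\ \max_{\alpha\,:\,p_\alpha\ne0}\ \sum_{i=1}^n\alpha_i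 y_i ,\qquad y\in\mathbb R^n,$$ where the maximum over the empty set is $-\infty$: each $\psi_y$ is such a homomorphism, and each such homomorphism equals $\psi_y$ for some $y\in\mathbb R^n$. Moreover, for every $y\in\mathbb R^n$ and every nonzero $p\in\mathrm{Schur}_n$, $\psi_y(p)$ is the maximum of the linear function $v\mapsto\sum_{i=1}^n v_iy_i$ over the Newton polytope of $p$, that is, over the convex hull of $\{\alpha\in\mathbb N^n: p_\alpha\neq0\}$. -/

import Mathlib

namespace SchurTrop

/-! ### Toggling tableaux -/

section Tableaux

variable {μ : YoungDiagram}

/-- Semistandard tableaux of shape `μ` with entries in `{0, …, n - 1}`. -/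
abbrev BoundedTableau (n : ℕ) (μ : YoungDiagram) : Type :=
  {T : SemistandardYoungTableau μ // ∀ i j, (i, j) ∈ μ → T i j < n}

/-- The number of entries of `T` that are equal to `k`. -/
def content (T : SemistandardYoungTableau μ) (k : ℕ) : ℕ :=
  (μ.cells.filter (fun c => T c.1 c.2 = k)).card

instance (n : ℕ) (μ : YoungDiagram) : Finite (BoundedTableau n μ) := by
  let f : BoundedTableau n μ → (μ.cells → Fin n) :=
    fun T c => ⟨T.1 c.1.1 c.1.2, T.2 _ _ c.2⟩
  refine Finite.of_injective f ?_
  intro T T' h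
  apply Subtype.ext
  ext i j
  by_cases hc : (i, j) ∈ μ
  · have := congrFun h ⟨(i, j), hc⟩
    simpa [f] using this
  · rw [T.1.zeros hc, T'.1.zeros hc]

noncomputable instance (n : ℕ) (μ : YoungDiagram) : Fintype (BoundedTableau n μ) :=
  Fintype.ofFinite _

/-- The number of entries `< m` in the part of row `i` to the left of column `J`. -/
def thr (T : SemistandardYoungTableau μ) (J m i : ℕ) : ℕ :=
  Nat.find (p := fun t => min (μ.rowLen i) J ≤ t ∨ m ≤ T i t) ⟨_, Or.inl le_rfl⟩

theorem thr_le (T : SemistandardYoungTableau μ) (J m i : ℕ) :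
    thr T J m i ≤ min (μ.rowLen i) J :=
  Nat.find_min' _ (Or.inl le_rfl)

theorem lt_thr (T : SemistandardYoungTableau μ) {J m i j : ℕ} (h : j < min (μ.rowLen i) J) :
    j < thr T J m i ↔ T i j < m := by
  constructor
  · intro hj
    have := Nat.find_min _ hj
    push Not at this
    exact this.2
  · intro hj
    by_contra hc
    push Not at hc
    have hs := Nat.find_spec (p := fun t => min (μ.rowLen i) J ≤ t ∨ m ≤ T i t) ⟨_, Or.inl le_rfl⟩
    change min (μ.rowLen i) J ≤ thr T J m i ∨ m ≤ T i (thr T J m i) at hs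
    rcases hs with hs | hs
    · omega
    · have := T.row_weak_of_le hc (YoungDiagram.mem_iff_lt_rowLen.2 (lt_of_lt_of_le h (min_le_left _ _)))
      omega

theorem thr_unique (T : SemistandardYoungTableau μ) {J m i t : ℕ} (ht : t ≤ min (μ.rowLen i) J)
    (h : ∀ j, j < min (μ.rowLen i) J → (j < t ↔ T i j < m)) : thr T J m i = t := by
  have h1 := thr_le T J m i
  rcases lt_trichotomy (thr T J m i) t with h2 | h2 | h2
  · have h3 : thr T J m i < min (μ.rowLen i) J := by omega
    have := (lt_thr T (m := m) h3).2 ((h _ h3).1 h2)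
    omega
  · exact h2
  · have h3 : t < min (μ.rowLen i) J := by omega
    have := (h _ h3).2 ((lt_thr T (m := m) h3).1 h2)
    omega

theorem thr_mono (T : SemistandardYoungTableau μ) (J i : ℕ) {m m' : ℕ} (hm : m ≤ m') :
    thr T J m i ≤ thr T J m' i := by
  by_contra hc
  push Not at hc
  have h1 := thr_le T J m i
  have h3 : thr T J m' i < min (μ.rowLen i) J := by omega
  have := (lt_thr T h3).1 hc
  have := (lt_thr T h3).2 (lt_of_lt_of_le this hm)
  omega

theorem thr_col (T : SemistandardYoungTableau μ) (J m i : ℕ) :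
    thr T J (m + 1) (i + 1) ≤ thr T J m i := by
  by_contra hc
  push Not at hc
  have h1 := thr_le T J (m + 1) (i + 1)
  have h2 := μ.rowLen_anti i (i + 1) (by omega)
  have h3 : thr T J m i < min (μ.rowLen (i + 1)) J := by omega
  have h4 : thr T J m i < min (μ.rowLen i) J := by omega
  have h5 := (lt_thr T h3).1 hc
  have h6 := T.col_strict (i1 := i) (i2 := i + 1) (j := thr T J m i) (by omega)
    (YoungDiagram.mem_iff_lt_rowLen.2 (by omega))
  have := (lt_thr T (m := m) h4).2 (by omega)
  omega

/-- Upper bound for the toggled threshold. -/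
def thrHi (T : SemistandardYoungTableau μ) (J k : ℕ) : ℕ → ℕ
  | 0 => thr T J (k + 2) 0
  | i + 1 => min (thr T J (k + 2) (i + 1)) (thr T J k i)

/-- Lower bound for the toggled threshold. -/
def thrLo (T : SemistandardYoungTableau μ) (J k i : ℕ) : ℕ :=
  max (thr T J k i) (thr T J (k + 2) (i + 1))

/-- The toggled threshold. -/
def thrNew (T : SemistandardYoungTableau μ) (J k i : ℕ) : ℕ :=
  thrLo T J k i + thrHi T J k i - thr T J (k + 1) i

theorem lo_le_thr (T : SemistandardYoungTableau μ) (J k i : ℕ) :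
    thrLo T J k i ≤ thr T J (k + 1) i :=
  max_le (thr_mono T J i (by omega)) (thr_col T J (k + 1) i)

theorem thr_le_hi (T : SemistandardYoungTableau μ) (J k i : ℕ) :
    thr T J (k + 1) i ≤ thrHi T J k i := by
  cases i with
  | zero => exact thr_mono T J 0 (by omega)
  | succ i => exact le_min (thr_mono T J _ (by omega)) (thr_col T J k i)

theorem hi_le (T : SemistandardYoungTableau μ) (J k i : ℕ) :
    thrHi T J k i ≤ thr T J (k + 2) i := by
  cases i with
  | zero => exact le_rfl
  | succ i => exact min_le_left _ _

theorem sum_lo_hi (T : SemistandardYoungTableau μ) (J k N : ℕ) :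
    ∑ i ∈ Finset.range N, (thrLo T J k i + thrHi T J k i) + thrHi T J k N =
      ∑ i ∈ Finset.range N, (thr T J k i + thr T J (k + 2) i) + thr T J (k + 2) N := by
  induction N with
  | zero => simp [thrHi]
  | succ N ih =>
    rw [Finset.sum_range_succ, Finset.sum_range_succ]
    have h : thrLo T J k N + thrHi T J k (N + 1) = thr T J k N + thr T J (k + 2) (N + 1) := by
      simp only [thrLo, thrHi]
      omega
    omega

/-- The toggled filling: in the columns to the left of `J`, the entries `k` and `k + 1` are
redistributed within each row. -/
def togEntry (T : SemistandardYoungTableau μ) (J k i j : ℕ) : ℕ :=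
  if (i, j) ∈ μ ∧ j < J ∧ (T i j = k ∨ T i j = k + 1) then
    (if j < thrNew T J k i then k else k + 1)
  else T i j

theorem togEntry_of_ge (T : SemistandardYoungTableau μ) {J k i j : ℕ} (h : J ≤ j) :
    togEntry T J k i j = T i j := by
  rw [togEntry, if_neg]
  omega

/-- The toggled tableau. -/
def tog (T : SemistandardYoungTableau μ) (J k : ℕ)
    (hJ : ∀ i, (i, J) ∈ μ → T i J ≠ k) : SemistandardYoungTableau μ where
  entry := togEntry T J k
  row_weak' := by
    intro i j1 j2 hj hc
    have hc1 : (i, j1) ∈ μ := μ.up_left_mem le_rfl hj.le hc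
    have h := T.row_weak hj hc
    unfold togEntry
    have key : J ≤ j2 → j1 < J → T i j1 = k ∨ T i j1 = k + 1 → T i j2 ≠ k := by
      intro h1 h2 h3 h4
      have hcJ : (i, J) ∈ μ := μ.up_left_mem le_rfl h1 hc
      have h5 := T.row_weak_of_le h2.le hcJ
      have h6 := T.row_weak_of_le h1 hc
      exact hJ i hcJ (by omega)
    simp only [hc, hc1, true_and]
    by_cases h2 : j1 < J <;> by_cases h3 : j2 < J <;> by_cases h4 : j1 < thrNew T J k i <;>
      by_cases h5 : j2 < thrNew T J k i <;> split_ifs <;> omega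
  col_strict' := by
    intro i1 i2 j hi hc
    have hc1 : (i1, j) ∈ μ := μ.up_left_mem hi.le le_rfl hc
    have h := T.col_strict hi hc
    unfold togEntry
    simp only [hc, hc1, true_and]
    by_cases h1 : (j < J ∧ (T i1 j = k ∨ T i1 j = k + 1)) ∧
      (j < J ∧ (T i2 j = k ∨ T i2 j = k + 1))
    · rw [if_pos h1.1, if_pos h1.2]
      have hJ' := h1.1.1
      have e1 : T i1 j = k := by omega
      have e2 : T i2 j = k + 1 := by omega
      have hi2 : i2 = i1 + 1 := by
        by_contra hne
        have hc3 : (i1 + 1, j) ∈ μ := μ.up_left_mem (by omega : i1 + 1 ≤ i2) le_rfl hc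
        have := T.col_strict (show i1 < i1 + 1 by omega) hc3
        have := T.col_strict (show i1 + 1 < i2 by omega) hc
        omega
      subst hi2
      have r1 := YoungDiagram.mem_iff_lt_rowLen.1 hc1
      have r2 := YoungDiagram.mem_iff_lt_rowLen.1 hc
      have a1 : ¬ j < thr T J k i1 := by rw [lt_thr T (by omega)]; omega
      have a2 : j < thr T J (k + 2) (i1 + 1) := by rw [lt_thr T (by omega)]; omega
      have b1 : j < thrNew T J k i1 := by
        have := thr_le_hi T J k i1
        have : thr T J (k + 2) (i1 + 1) ≤ thrLo T J k i1 := le_max_right _ _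
        unfold thrNew
        omega
      have b2 : ¬ j < thrNew T J k (i1 + 1) := by
        have := lo_le_thr T J k (i1 + 1)
        have : thrHi T J k (i1 + 1) ≤ thr T J k i1 := min_le_right _ _
        unfold thrNew
        omega
      rw [if_pos b1, if_neg b2]
      omega
    · split_ifs <;> omega
  zeros' := by
    intro i j hc
    rw [togEntry, if_neg (fun h => hc h.1), T.zeros hc]

variable {T : SemistandardYoungTableau μ} {J k : ℕ} {hJ : ∀ i, (i, J) ∈ μ → T i J ≠ k}

theorem tog_apply (i j : ℕ) : tog T J k hJ i j = togEntry T J k i j := rfl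

theorem thr_tog_of_ne (i : ℕ) {m : ℕ} (hm : m ≠ k + 1) :
    thr (tog T J k hJ) J m i = thr T J m i := by
  apply thr_unique _ (thr_le _ _ _ _)
  intro j hj
  rw [lt_thr T hj, tog_apply, togEntry]
  split_ifs <;> omega

theorem thr_tog (i : ℕ) : thr (tog T J k hJ) J (k + 1) i = thrNew T J k i := by
  have h1 := lo_le_thr T J k i
  have h2 := thr_le_hi T J k i
  have h3 := hi_le T J k i
  have h4 := thr_le T J (k + 2) i
  have h5 : thr T J k i ≤ thrLo T J k i := le_max_left _ _
  have h0 : thrNew T J k i = thrLo T J k i + thrHi T J k i - thr T J (k + 1) i := rfl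
  apply thr_unique
  · omega
  · intro j hj
    have e1 := lt_thr T (m := k) hj
    have e2 := lt_thr T (m := k + 2) hj
    have hc : (i, j) ∈ μ := YoungDiagram.mem_iff_lt_rowLen.2 (by omega)
    rw [tog_apply, togEntry]
    simp only [hc, true_and]
    split_ifs <;> omega

theorem thrLo_tog (i : ℕ) : thrLo (tog T J k hJ) J k i = thrLo T J k i := by
  rw [thrLo, thr_tog_of_ne _ (by omega), thr_tog_of_ne _ (by omega), thrLo]

theorem thrHi_tog (i : ℕ) : thrHi (tog T J k hJ) J k i = thrHi T J k i := by
  cases i with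
  | zero => rw [thrHi, thr_tog_of_ne _ (by omega), thrHi]
  | succ i => rw [thrHi, thr_tog_of_ne _ (by omega), thr_tog_of_ne _ (by omega), thrHi]

theorem thrNew_tog (i : ℕ) : thrNew (tog T J k hJ) J k i = thr T J (k + 1) i := by
  rw [thrNew, thrLo_tog, thrHi_tog, thr_tog, thrNew]
  have h1 := lo_le_thr T J k i
  have h2 := thr_le_hi T J k i
  omega

theorem tog_col (i : ℕ) (h : (i, J) ∈ μ) : tog T J k hJ i J ≠ k := by
  rw [tog_apply, togEntry_of_ge T le_rfl]
  exact hJ i h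

theorem tog_tog : tog (tog T J k hJ) J k tog_col = T := by
  ext i j
  rw [tog_apply, togEntry]
  by_cases h : (i, j) ∈ μ ∧ j < J
  · obtain ⟨hc, hj⟩ := h
    have hc' := YoungDiagram.mem_iff_lt_rowLen.1 hc
    have e1 := lt_thr T (J := J) (m := k + 1) (i := i) (j := j) (by omega)
    simp only [hc, hj, true_and]
    rw [thrNew_tog]
    simp only [tog_apply, togEntry, hc, hj, true_and]
    split_ifs <;> omega
  · rw [if_neg (by tauto), tog_apply, togEntry, if_neg (by tauto)]

/-- The number of entries `k` to the left of column `J`. -/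
def leftContent (T : SemistandardYoungTableau μ) (J k : ℕ) : ℕ :=
  (μ.cells.filter (fun c => c.2 < J ∧ T c.1 c.2 = k)).card

/-- The number of entries `k` in column `J` and to the right of it. -/
def rightContent (T : SemistandardYoungTableau μ) (J k : ℕ) : ℕ :=
  (μ.cells.filter (fun c => J ≤ c.2 ∧ T c.1 c.2 = k)).card

theorem content_eq (T : SemistandardYoungTableau μ) (J k : ℕ) :
    content T k = leftContent T J k + rightContent T J k := by
  unfold content leftContent rightContent
  rw [← Finset.card_union_of_disjoint]
  · congr 1
    ext c
    simp only [Finset.mem_filter, Finset.mem_union]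
    have := lt_or_ge c.2 J
    tauto
  · rw [Finset.disjoint_filter]
    intro c _ h1 h2
    omega

theorem leftContent_eq_sum (T : SemistandardYoungTableau μ) (J k : ℕ) :
    leftContent T J k =
      ∑ i ∈ Finset.range (μ.colLen 0), (thr T J (k + 1) i - thr T J k i) := by
  unfold leftContent
  rw [Finset.card_eq_sum_card_fiberwise (f := Prod.fst) (t := Finset.range (μ.colLen 0))]
  · refine Finset.sum_congr rfl fun i _ => ?_
    trans ((Finset.Ico (thr T J k i) (thr T J (k + 1) i)).map
      (⟨fun j => (i, j), fun a b h => by simpa using h⟩ : ℕ ↪ ℕ × ℕ)).card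
    swap
    · rw [Finset.card_map, Nat.card_Ico]
    apply congrArg Finset.card
    ext ⟨a, j⟩
    simp only [Finset.mem_filter, YoungDiagram.mem_cells, Finset.mem_map, Finset.mem_Ico]
    constructor
    · rintro ⟨⟨hc, hj, hT⟩, rfl⟩
      have hc' := YoungDiagram.mem_iff_lt_rowLen.1 hc
      have e1 := lt_thr T (J := J) (m := k + 1) (i := a) (j := j) (by omega)
      have e2 := lt_thr T (J := J) (m := k) (i := a) (j := j) (by omega)
      exact ⟨j, by omega, rfl⟩
    · rintro ⟨j', ⟨h1, h2⟩, he⟩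
      obtain ⟨rfl, rfl⟩ := Prod.mk.inj he
      have h3 := thr_le T J (k + 1) i
      have e1 := lt_thr T (J := J) (m := k + 1) (i := i) (j := j') (by omega)
      have e2 := lt_thr T (J := J) (m := k) (i := i) (j := j') (by omega)
      exact ⟨⟨YoungDiagram.mem_iff_lt_rowLen.2 (by omega), by omega, by omega⟩, rfl⟩
  · rintro ⟨i, j⟩ h
    simp only [Finset.coe_filter, YoungDiagram.mem_cells, Set.mem_ofPred_eq] at h
    simp only [Finset.coe_range, Set.mem_Iio]
    exact YoungDiagram.mem_iff_lt_colLen.1 (μ.up_left_mem le_rfl (Nat.zero_le _) h.1)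

theorem rightContent_tog (m : ℕ) : rightContent (tog T J k hJ) J m = rightContent T J m := by
  unfold rightContent
  congr 1
  apply Finset.filter_congr
  intro c _
  constructor
  · rintro ⟨h1, h2⟩
    rw [tog_apply, togEntry_of_ge T h1] at h2
    exact ⟨h1, h2⟩
  · rintro ⟨h1, h2⟩
    rw [tog_apply, togEntry_of_ge T h1]
    exact ⟨h1, h2⟩

theorem leftContent_tog_aux : leftContent (tog T J k hJ) J k = leftContent T J (k + 1) := by
  rw [leftContent_eq_sum, leftContent_eq_sum]
  have h0 : μ.rowLen (μ.colLen 0) = 0 := by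
    by_contra h
    have h1 : (μ.colLen 0, 0) ∈ μ := YoungDiagram.mem_iff_lt_rowLen.2 (by omega)
    have := YoungDiagram.mem_iff_lt_colLen.1 h1
    omega
  have h1 := sum_lo_hi T J k (μ.colLen 0)
  have h2 := hi_le T J k (μ.colLen 0)
  have h3 := thr_le T J (k + 2) (μ.colLen 0)
  have h4 : ∑ i ∈ Finset.range (μ.colLen 0), (thrLo T J k i + thrHi T J k i) =
      ∑ i ∈ Finset.range (μ.colLen 0), (thr T J k i + thr T J (k + 2) i) := by omega
  have h5 : ∑ i ∈ Finset.range (μ.colLen 0),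
        (thr (tog T J k hJ) J (k + 1) i - thr (tog T J k hJ) J k i) +
        ∑ i ∈ Finset.range (μ.colLen 0), (thr T J k i + thr T J (k + 1) i) =
      ∑ i ∈ Finset.range (μ.colLen 0), (thrLo T J k i + thrHi T J k i) := by
    rw [← Finset.sum_add_distrib]
    refine Finset.sum_congr rfl fun i _ => ?_
    rw [thr_tog, thr_tog_of_ne _ (by omega), thrNew]
    have := lo_le_thr T J k i
    have := thr_le_hi T J k i
    have : thr T J k i ≤ thrLo T J k i := le_max_left _ _
    omega
  have h6 : ∑ i ∈ Finset.range (μ.colLen 0), (thr T J (k + 1 + 1) i - thr T J (k + 1) i) +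
        ∑ i ∈ Finset.range (μ.colLen 0), (thr T J k i + thr T J (k + 1) i) =
      ∑ i ∈ Finset.range (μ.colLen 0), (thr T J k i + thr T J (k + 2) i) := by
    rw [← Finset.sum_add_distrib]
    refine Finset.sum_congr rfl fun i _ => ?_
    have : thr T J (k + 1) i ≤ thr T J (k + 1 + 1) i := thr_mono T J i (by omega)
    have : thr T J (k + 1 + 1) i = thr T J (k + 2) i := rfl
    omega
  omega

theorem leftContent_tog (m : ℕ) :
    leftContent (tog T J k hJ) J m = leftContent T J (Equiv.swap k (k + 1) m) := by
  by_cases h1 : m = k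
  · subst h1
    rw [Equiv.swap_apply_left, leftContent_tog_aux]
  · by_cases h2 : m = k + 1
    · subst h2
      rw [Equiv.swap_apply_right]
      conv_rhs => rw [← tog_tog (T := T) (J := J) (k := k) (hJ := hJ)]
      rw [leftContent_tog_aux]
    · rw [Equiv.swap_apply_of_ne_of_ne h1 h2]
      unfold leftContent
      congr 1
      apply Finset.filter_congr
      intro c _
      rw [tog_apply, togEntry]
      split_ifs <;> omega

theorem tog_lt {n : ℕ} (hk : k + 1 < n) (hT : ∀ i j, (i, j) ∈ μ → T i j < n) :
    ∀ i j, (i, j) ∈ μ → tog T J k hJ i j < n := by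
  intro i j h
  have := hT i j h
  rw [tog_apply, togEntry]
  split_ifs <;> omega

end Tableaux

end SchurTrop
namespace SchurTrop

/-! ### Schur polynomials -/

open MvPolynomial

/-- The Schur polynomial `s_μ` in the `n` variables `x_0, …, x_{n-1}`: the sum of the monomials
`x^T` over all semistandard tableaux `T` of shape `μ` with entries in `{0, …, n - 1}`. -/
noncomputable def schurPoly (n : ℕ) (μ : YoungDiagram) : MvPolynomial (Fin n) ℤ :=
  ∑ T : BoundedTableau n μ, ∏ k : Fin n, X k ^ content T.1 k

section Positivity

theorem rename_swap_schurPoly (n : ℕ) (μ : YoungDiagram) (k : ℕ) (hk : k + 1 < n) :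
    rename (Equiv.swap (⟨k, by omega⟩ : Fin n) ⟨k + 1, hk⟩) (schurPoly n μ) = schurPoly n μ := by
  have hcol (T : BoundedTableau n μ) : ∀ i, (i, μ.rowLen 0) ∈ μ → T.1 i (μ.rowLen 0) ≠ k := by
    intro i hi
    have := YoungDiagram.mem_iff_lt_rowLen.1 hi
    have := μ.rowLen_anti 0 i (by omega)
    omega
  let e : BoundedTableau n μ ≃ BoundedTableau n μ :=
    Function.Involutive.toPerm
      (fun T => ⟨tog T.1 (μ.rowLen 0) k (hcol T), tog_lt hk T.2⟩)
      (fun T => Subtype.ext (tog_tog (hJ := hcol T)))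
  have hcont (T : SemistandardYoungTableau μ) (m : ℕ) :
      content T m = leftContent T (μ.rowLen 0) m := by
    rw [content_eq T (μ.rowLen 0), Nat.add_eq_left]
    unfold rightContent
    rw [Finset.card_eq_zero, Finset.filter_eq_empty_iff]
    rintro ⟨i, j⟩ hc ⟨h1, -⟩
    have := YoungDiagram.mem_iff_lt_rowLen.1 (show (i, j) ∈ μ from hc)
    have := μ.rowLen_anti 0 i (by omega)
    simp only at h1
    omega
  unfold schurPoly
  rw [map_sum]
  refine Fintype.sum_equiv e _ _ fun T => ?_
  rw [map_prod]
  refine Fintype.prod_equiv (Equiv.swap (⟨k, by omega⟩ : Fin n) ⟨k + 1, hk⟩) _ _ fun m => ?_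
  rw [map_pow, rename_X]
  congr 1
  change content T.1 m = content (tog T.1 (μ.rowLen 0) k (hcol T)) _
  rw [hcont, hcont, leftContent_tog]
  congr 1
  have hv : ((Equiv.swap (⟨k, by omega⟩ : Fin n) ⟨k + 1, hk⟩ m : Fin n) : ℕ) =
      Equiv.swap k (k + 1) (m : ℕ) := by
    simp only [Equiv.swap_apply_def, Fin.ext_iff]
    split_ifs <;> rfl
  rw [hv, Equiv.swap_apply_self]

theorem rename_schurPoly (n : ℕ) (μ : YoungDiagram) (σ : Equiv.Perm (Fin n)) :
    rename σ (schurPoly n μ) = schurPoly n μ := by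
  cases n with
  | zero =>
    have : σ = 1 := Subsingleton.elim _ _
    subst this
    exact rename_id_apply _
  | succ n =>
    have h : σ ∈ Submonoid.closure
        (Set.range fun i : Fin n => Equiv.swap i.castSucc i.succ) := by
      rw [Equiv.Perm.mclosure_swap_castSucc_succ]
      trivial
    induction h using Submonoid.closure_induction with
    | mem x hx =>
      obtain ⟨i, rfl⟩ := hx
      exact rename_swap_schurPoly (n + 1) μ i (by omega)
    | one => exact rename_id_apply _
    | mul x y _ _ hx hy =>
      rw [Equiv.Perm.coe_mul, ← rename_rename, hy, hx]

/-- The alternant with exponents `α_j + (n - 1 - j)`. -/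
noncomputable def alt (n : ℕ) (α : ℕ → ℕ) : MvPolynomial (Fin n) ℤ :=
  Matrix.det (Matrix.of fun i j : Fin n => (X i : MvPolynomial (Fin n) ℤ) ^ (α j + (n - 1 - j)))

theorem alt_mul_schurPoly (n : ℕ) (α : ℕ → ℕ) (μ : YoungDiagram) :
    alt n α * schurPoly n μ =
      ∑ T : BoundedTableau n μ, alt n (fun k => α k + content T.1 k) := by
  simp only [alt, Matrix.det_apply, Finset.sum_mul]
  rw [Finset.sum_comm]
  refine Finset.sum_congr rfl fun σ _ => ?_
  conv_lhs => rw [← rename_schurPoly n μ σ]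
  rw [schurPoly, map_sum, Finset.mul_sum]
  refine Finset.sum_congr rfl fun T _ => ?_
  rw [smul_mul_assoc, map_prod, ← Finset.prod_mul_distrib]
  congr 1
  refine Finset.prod_congr rfl fun k _ => ?_
  rw [map_pow, rename_X, Matrix.of_apply, Matrix.of_apply, ← pow_add]
  congr 1
  omega

theorem alt_swap (n : ℕ) (α β : ℕ → ℕ) (k : ℕ) (hk : k + 1 < n) (h1 : β k + 1 = α (k + 1))
    (h2 : β (k + 1) = α k + 1) (h : ∀ m, m ≠ k → m ≠ k + 1 → β m = α m) :
    alt n β = - alt n α := by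
  have hs := Matrix.det_permute' (Equiv.swap (⟨k, by omega⟩ : Fin n) ⟨k + 1, hk⟩)
    (Matrix.of fun i j : Fin n => (X i : MvPolynomial (Fin n) ℤ) ^ (α j + (n - 1 - j)))
  rw [Equiv.Perm.sign_swap (by simp [Fin.ext_iff])] at hs
  unfold alt
  rw [show ∀ x : MvPolynomial (Fin n) ℤ, -x = ((-1 : ℤˣ) : ℤ) * x by intro x; simp, ← hs]
  congr 1
  ext1 i j
  simp only [Matrix.of_apply, Matrix.submatrix_apply, id]
  congr 1
  by_cases e1 : j = ⟨k, by omega⟩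
  · subst e1
    rw [Equiv.swap_apply_left]
    simp only
    omega
  · by_cases e2 : j = ⟨k + 1, hk⟩
    · subst e2
      rw [Equiv.swap_apply_right]
      simp only
      omega
    · rw [Equiv.swap_apply_of_ne_of_ne e1 e2, h]
      · exact fun h => e1 (Fin.ext h)
      · exact fun h => e2 (Fin.ext h)

theorem alt_zero_ne_zero (n : ℕ) : alt n (fun _ => 0) ≠ 0 := by
  have hv : (Matrix.vandermonde (X : Fin n → MvPolynomial (Fin n) ℤ)).det ≠ 0 :=
    Matrix.det_vandermonde_ne_zero_iff.2 (X_injective)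
  have hs := Matrix.det_permute' (Fin.revPerm (n := n))
    (Matrix.vandermonde (X : Fin n → MvPolynomial (Fin n) ℤ))
  have : alt n (fun _ => 0) =
      ((Matrix.vandermonde (X : Fin n → MvPolynomial (Fin n) ℤ)).submatrix id Fin.revPerm).det := by
    unfold alt
    congr 1
    ext1 i j
    simp only [Matrix.of_apply, Matrix.submatrix_apply, id, Matrix.vandermonde_apply,
      Fin.revPerm_apply, Fin.val_rev]
    congr 1
    omega
  rw [this, hs]
  refine mul_ne_zero ?_ hv
  rcases Int.units_eq_one_or (Equiv.Perm.sign (Fin.revPerm (n := n))) with h | h <;> simp [h]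

variable {ν : YoungDiagram}

/-- Adding the columns of `T` from `J` on to `m` breaks dominance in position `k`. -/
def Bad (n : ℕ) (m : ℕ → ℕ) (T : SemistandardYoungTableau ν) (J k : ℕ) : Prop :=
  k + 1 < n ∧ m k + rightContent T J k < m (k + 1) + rightContent T J (k + 1)

/-- `(J, k)` is the first place, reading columns from right to left, where `T` is bad. -/
def Sel (n : ℕ) (m : ℕ → ℕ) (T : SemistandardYoungTableau ν) (J k : ℕ) : Prop :=
  Bad n m T J k ∧ (∀ J' k', J < J' → ¬ Bad n m T J' k') ∧ ∀ k', k' < k → ¬ Bad n m T J k'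

theorem Sel.unique {n : ℕ} {m : ℕ → ℕ} {T : SemistandardYoungTableau ν} {J k J' k' : ℕ}
    (h : Sel n m T J k) (h' : Sel n m T J' k') : J = J' ∧ k = k' := by
  have hJ : J = J' := by
    rcases lt_trichotomy J J' with hl | hl | hl
    · exact absurd h'.1 (h.2.1 _ _ hl)
    · exact hl
    · exact absurd h.1 (h'.2.1 _ _ hl)
  subst hJ
  refine ⟨rfl, ?_⟩
  rcases lt_trichotomy k k' with hl | hl | hl
  · exact absurd h.1 (h'.2.2 _ hl)
  · exact hl
  · exact absurd h'.1 (h.2.2 _ hl)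

theorem rightContent_eq_zero (T : SemistandardYoungTableau ν) {J : ℕ} (hJ : ν.rowLen 0 ≤ J)
    (k : ℕ) : rightContent T J k = 0 := by
  unfold rightContent
  rw [Finset.card_eq_zero, Finset.filter_eq_empty_iff]
  rintro ⟨i, j⟩ hc ⟨h1, -⟩
  have := YoungDiagram.mem_iff_lt_rowLen.1 (show (i, j) ∈ ν from hc)
  have := ν.rowLen_anti 0 i (by omega)
  simp only at h1
  omega

theorem exists_sel {n : ℕ} {m : ℕ → ℕ} (hm : Antitone m) {T : SemistandardYoungTableau ν}
    {J k : ℕ} (h : Bad n m T J k) : ∃ J k, Sel n m T J k := by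
  classical
  have hb : ∀ J k, Bad n m T J k → J ≤ ν.rowLen 0 := by
    intro J k hB
    by_contra hc
    have h1 := rightContent_eq_zero T (J := J) (by omega) k
    have h2 := rightContent_eq_zero T (J := J) (by omega) (k + 1)
    have h3 := hm (show k ≤ k + 1 by omega)
    have := hB.2
    omega
  let P : ℕ → Prop := fun J => ∃ k, Bad n m T J k
  have h1 : P (Nat.findGreatest P (ν.rowLen 0)) := Nat.findGreatest_spec (hb J k h) ⟨k, h⟩
  refine ⟨_, Nat.find h1, Nat.find_spec h1, ?_, fun k' hk' => Nat.find_min h1 hk'⟩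
  intro J' k' hlt hB
  exact Nat.findGreatest_is_greatest hlt (hb _ _ hB) ⟨k', hB⟩

theorem rightContent_succ (T : SemistandardYoungTableau ν) (J k : ℕ) :
    rightContent T J k =
      rightContent T (J + 1) k + (ν.cells.filter (fun c => c.2 = J ∧ T c.1 c.2 = k)).card := by
  unfold rightContent
  rw [← Finset.card_union_of_disjoint]
  · congr 1
    ext c
    simp only [Finset.mem_filter, Finset.mem_union]
    have : J ≤ c.2 ↔ J + 1 ≤ c.2 ∨ c.2 = J := by omega
    tauto
  · rw [Finset.disjoint_filter]
    intro c _ h1 h2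
    omega

theorem card_col_le_one (T : SemistandardYoungTableau ν) (J k : ℕ) :
    (ν.cells.filter (fun c => c.2 = J ∧ T c.1 c.2 = k)).card ≤ 1 := by
  rw [Finset.card_le_one]
  rintro ⟨i, j⟩ h ⟨i', j'⟩ h'
  simp only [Finset.mem_filter, YoungDiagram.mem_cells] at h h'
  obtain ⟨h1, rfl, h2⟩ := h
  obtain ⟨h3, rfl, h4⟩ := h'
  rcases lt_trichotomy i i' with hl | hl | hl
  · have := T.col_strict hl h3
    omega
  · rw [hl]
  · have := T.col_strict hl h1
    omega

theorem Sel.col {n : ℕ} {m : ℕ → ℕ} {T : SemistandardYoungTableau ν} {J k : ℕ}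
    (h : Sel n m T J k) : (∀ i, (i, J) ∈ ν → T i J ≠ k) ∧
      m k + rightContent T J k + 1 = m (k + 1) + rightContent T J (k + 1) := by
  have h1 := h.1.2
  have h2 : ¬ Bad n m T (J + 1) k := h.2.1 _ _ (by omega)
  have h3 : ¬ m k + rightContent T (J + 1) k < m (k + 1) + rightContent T (J + 1) (k + 1) :=
    fun hh => h2 ⟨h.1.1, hh⟩
  have h4 := rightContent_succ T J k
  have h5 := rightContent_succ T J (k + 1)
  have h6 := card_col_le_one T J (k + 1)
  refine ⟨?_, by omega⟩
  intro i hi hT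
  have : 0 < (ν.cells.filter (fun c => c.2 = J ∧ T c.1 c.2 = k)).card := by
    rw [Finset.card_pos]
    exact ⟨(i, J), by simp [hi, hT]⟩
  omega

theorem Bad.tog_iff {n : ℕ} {m : ℕ → ℕ} {T : SemistandardYoungTableau ν} {J k : ℕ}
    {hJ : ∀ i, (i, J) ∈ ν → T i J ≠ k} {J' k' : ℕ} (hJ' : J ≤ J') :
    Bad n m (tog T J k hJ) J' k' ↔ Bad n m T J' k' := by
  have (p : ℕ) : rightContent (tog T J k hJ) J' p = rightContent T J' p := by
    unfold rightContent
    congr 1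
    apply Finset.filter_congr
    intro c _
    by_cases hc : J' ≤ c.2
    · rw [tog_apply, togEntry_of_ge T (by omega)]
    · simp [hc]
  rw [Bad, Bad, this, this]

theorem Sel.tog {n : ℕ} {m : ℕ → ℕ} {T : SemistandardYoungTableau ν} {J k : ℕ}
    (h : Sel n m T J k) {hJ : ∀ i, (i, J) ∈ ν → T i J ≠ k} : Sel n m (tog T J k hJ) J k := by
  refine ⟨(Bad.tog_iff le_rfl).2 h.1, fun J' k' hl => ?_, fun k' hl => ?_⟩
  · rw [Bad.tog_iff hl.le]
    exact h.2.1 _ _ hl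
  · rw [Bad.tog_iff le_rfl]
    exact h.2.2 _ hl

theorem alt_tog {n : ℕ} {m : ℕ → ℕ} {T : SemistandardYoungTableau ν} {J k : ℕ}
    (h : Sel n m T J k) {hJ : ∀ i, (i, J) ∈ ν → T i J ≠ k} :
    alt n (fun p => m p + content (SchurTrop.tog T J k hJ) p) =
      - alt n (fun p => m p + content T p) := by
  have h1 := h.col.2
  apply alt_swap n _ _ k h.1.1
  · simp only [content_eq _ J, rightContent_tog, leftContent_tog, Equiv.swap_apply_left]
    omega
  · simp only [content_eq _ J, rightContent_tog, leftContent_tog, Equiv.swap_apply_right]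
    omega
  · intro p hp1 hp2
    simp only [content_eq _ J, rightContent_tog, leftContent_tog,
      Equiv.swap_apply_of_ne_of_ne hp1 hp2]

/-- `T` is good for `m` if it is bad nowhere. -/
def Good (n : ℕ) (m : ℕ → ℕ) (T : SemistandardYoungTableau ν) : Prop :=
  ∀ J k, ¬ Bad n m T J k

open Classical in
theorem sum_alt_eq (n : ℕ) {m : ℕ → ℕ} (hm : Antitone m) :
    ∑ T : BoundedTableau n ν, alt n (fun k => m k + content T.1 k) =
      ∑ T : BoundedTableau n ν with Good n m T.1, alt n (fun k => m k + content T.1 k) := by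
  suffices hsum : ∀ s : Finset (BoundedTableau n ν), (∀ T, T ∈ s ↔ ¬ Good n m T.1) →
      ∑ T ∈ s, alt n (fun k => m k + content T.1 k) = 0 by
    rw [← Finset.sum_filter_add_sum_filter_not Finset.univ
      (fun T : BoundedTableau n ν => Good n m T.1), add_eq_left]
    exact hsum _ (by simp)
  intro s hs
  have hsel (T : BoundedTableau n ν) (hT : ¬ Good n m T.1) : ∃ J k, Sel n m T.1 J k := by
    unfold Good at hT
    push Not at hT
    obtain ⟨J, k, h⟩ := hT
    exact exists_sel hm h
  choose fJ fk hf using hsel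
  have hmem {T : BoundedTableau n ν} (h : T ∈ s) : ¬ Good n m T.1 := (hs T).1 h
  let g : (T : BoundedTableau n ν) →
      T ∈ s → BoundedTableau n ν :=
    fun T h => ⟨tog T.1 (fJ T (hmem h)) (fk T (hmem h)) (hf T (hmem h)).col.1,
      tog_lt (hf T (hmem h)).1.1 T.2⟩
  have hg : ∀ T h, alt n (fun k => m k + content (g T h).1 k) =
      - alt n (fun k => m k + content T.1 k) := fun T h => alt_tog (hf T (hmem h)) (hJ := (hf T (hmem h)).col.1)
  have hgs : ∀ T h, Sel n m (g T h).1 (fJ T (hmem h)) (fk T (hmem h)) :=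
    fun T h => (hf T (hmem h)).tog (hJ := (hf T (hmem h)).col.1)
  refine Finset.sum_involution g ?_ ?_ ?_ ?_
  · intro T h
    rw [hg T h, add_neg_cancel]
  · intro T h hne heq
    have := hg T h
    rw [heq] at this
    exact hne (self_eq_neg.1 this)
  · intro T h
    rw [hs]
    exact fun hh => hh _ _ (hgs T h).1
  · intro T h
    have hbad : ¬ Good n m (g T h).1 := fun hh => hh _ _ (hgs T h).1
    have hu := (hf (g T h) hbad).unique (hgs T h)
    apply Subtype.ext
    change tog (g T h).1 (fJ (g T h) hbad) (fk (g T h) hbad) (hf (g T h) hbad).col.1 = T.1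
    have key : ∀ (J k : ℕ) (hc : ∀ i, (i, J) ∈ ν → (g T h).1 i J ≠ k),
        J = fJ T (hmem h) → k = fk T (hmem h) → tog (g T h).1 J k hc = T.1 := by
      rintro J k hc rfl rfl
      exact tog_tog (hJ := (hf T (hmem h)).col.1)
    exact key _ _ (hf (g T h) hbad).col.1 hu.1 hu.2

/-- The Young diagram with row lengths `f 0 ≥ f 1 ≥ … ≥ f (n - 1)`. -/
def diagramOf (n : ℕ) (f : ℕ → ℕ) (hf : ∀ i, i + 1 < n → f (i + 1) ≤ f i) : YoungDiagram where
  cells := (Finset.range n).biUnion fun i => (Finset.range (f i)).image fun j => (i, j)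
  isLowerSet := by
    have hmono : ∀ d i, i + d < n → f (i + d) ≤ f i := by
      intro d
      induction d with
      | zero => intro i _; exact le_rfl
      | succ d ih =>
        intro i hi
        exact (hf (i + d) (by omega)).trans (ih i (by omega))
    rintro ⟨i, j⟩ ⟨i', j'⟩ hle hc
    simp only [Finset.coe_biUnion, Finset.coe_range, Set.mem_Iio, Finset.coe_image,
      Set.mem_iUnion, Set.mem_image, Prod.mk.injEq, exists_prop] at hc ⊢
    obtain ⟨a, ha, b, hb, rfl, rfl⟩ := hc
    obtain ⟨h1, h2⟩ := Prod.mk_le_mk.1 hle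
    have := hmono (a - i') i' (by omega)
    rw [show i' + (a - i') = a by omega] at this
    exact ⟨i', by omega, j', by omega, rfl, rfl⟩

theorem mem_diagramOf {n : ℕ} {f : ℕ → ℕ} {hf : ∀ i, i + 1 < n → f (i + 1) ≤ f i} {i j : ℕ} :
    (i, j) ∈ diagramOf n f hf ↔ i < n ∧ j < f i := by
  rw [← YoungDiagram.mem_cells]
  simp [diagramOf]

theorem rowLen_diagramOf {n : ℕ} {f : ℕ → ℕ} {hf : ∀ i, i + 1 < n → f (i + 1) ≤ f i} {i : ℕ}
    (hi : i < n) : (diagramOf n f hf).rowLen i = f i := by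
  apply le_antisymm
  · by_contra hc
    have := mem_diagramOf.1 (YoungDiagram.mem_iff_lt_rowLen.2
      (show f i < (diagramOf n f hf).rowLen i by omega))
    omega
  · by_contra hc
    have := YoungDiagram.mem_iff_lt_rowLen.1 ((mem_diagramOf (hf := hf)).2
      (show i < n ∧ (diagramOf n f hf).rowLen i < f i by omega))
    omega

theorem colLen_diagramOf {n : ℕ} {f : ℕ → ℕ} {hf : ∀ i, i + 1 < n → f (i + 1) ≤ f i} :
    (diagramOf n f hf).colLen 0 ≤ n := by
  by_contra hc
  have := mem_diagramOf.1 (YoungDiagram.mem_iff_lt_colLen.2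
    (show n < (diagramOf n f hf).colLen 0 by omega))
  omega

theorem rightContent_highestWeight (ν : YoungDiagram) (J k : ℕ) :
    rightContent (SemistandardYoungTableau.highestWeight ν) J k = ν.rowLen k - J := by
  unfold rightContent
  trans ((Finset.Ico J (ν.rowLen k)).map
    (⟨fun j => (k, j), fun a b h => by simpa using h⟩ : ℕ ↪ ℕ × ℕ)).card
  swap
  · rw [Finset.card_map, Nat.card_Ico]
  apply congrArg Finset.card
  ext ⟨i, j⟩
  simp only [Finset.mem_filter, YoungDiagram.mem_cells, Finset.mem_map, Finset.mem_Ico]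
  rw [SemistandardYoungTableau.highestWeight_apply]
  constructor
  · rintro ⟨hc, h1, h2⟩
    rw [if_pos hc] at h2
    subst h2
    exact ⟨j, ⟨h1, YoungDiagram.mem_iff_lt_rowLen.1 hc⟩, rfl⟩
  · rintro ⟨j', ⟨h1, h2⟩, he⟩
    obtain ⟨rfl, rfl⟩ := Prod.mk.inj he
    have hc := YoungDiagram.mem_iff_lt_rowLen.2 h2
    exact ⟨hc, h1, by rw [if_pos hc]⟩

theorem le_entry (T : SemistandardYoungTableau ν) (i j : ℕ) (h : (i, j) ∈ ν) : i ≤ T i j := by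
  induction i with
  | zero => omega
  | succ i ih =>
    have h1 := ih (ν.up_left_mem (show i ≤ i + 1 by omega) le_rfl h)
    have := T.col_strict (show i < i + 1 by omega) h
    omega

theorem Good.entry_eq {n : ℕ} {T : SemistandardYoungTableau ν}
    (hT : ∀ i j, (i, j) ∈ ν → T i j < n) (hg : Good n (fun _ => 0) T) :
    ∀ d i j, ν.rowLen 0 ≤ j + d → (i, j) ∈ ν → T i j = i := by
  intro d
  induction d with
  | zero =>
    intro i j h hc
    have := YoungDiagram.mem_iff_lt_rowLen.1 hc
    have := ν.rowLen_anti 0 i (by omega)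
    omega
  | succ d ih =>
    intro i
    induction i using Nat.strong_induction_on with
    | _ i ihi =>
      intro j hd hc
      by_contra hne
      have hge := le_entry T i j hc
      by_cases hc1 : (i, j + 1) ∈ ν
      · have h1 := ih i (j + 1) (by omega) hc1
        have h2 := T.row_weak (show j < j + 1 by omega) hc1
        omega
      · obtain ⟨k, hk⟩ : ∃ k, T i j = k + 1 := ⟨T i j - 1, by omega⟩
        apply hg j k
        refine ⟨by rw [← hk]; exact hT i j hc, ?_⟩
        have hz : rightContent T j k = 0 := by
          unfold rightContent
          rw [Finset.card_eq_zero, Finset.filter_eq_empty_iff]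
          rintro ⟨a, b⟩ hab ⟨h1, h2⟩
          simp only [YoungDiagram.mem_cells] at hab h1 h2
          rcases Nat.eq_or_lt_of_le h1 with h3 | h3
          · subst h3
            rcases lt_trichotomy a i with h4 | h4 | h4
            · have := ihi a h4 j hd hab
              omega
            · subst h4
              omega
            · have := T.col_strict h4 hab
              omega
          · have h4 := ih a b (by omega) hab
            have h5 : (i, j + 1) ∈ ν := ν.up_left_mem (by omega) (by omega) hab
            exact hc1 h5
        have hp : 0 < rightContent T j (k + 1) := by
          unfold rightContent
          rw [Finset.card_pos]
          exact ⟨(i, j), by simp [hc, hk]⟩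
        simp only
        omega

/-- The quotient-of-alternants formula for Schur polynomials. -/
theorem alt_zero_mul_schurPoly (n : ℕ) (ν : YoungDiagram) (hν : ν.colLen 0 ≤ n) :
    alt n (fun _ => 0) * schurPoly n ν = alt n ν.rowLen := by
  classical
  rw [alt_mul_schurPoly, sum_alt_eq n (fun _ _ _ => le_rfl)]
  have hb : ∀ i j, (i, j) ∈ ν → SemistandardYoungTableau.highestWeight ν i j < n := by
    intro i j h
    rw [SemistandardYoungTableau.highestWeight_apply, if_pos h]
    have := YoungDiagram.mem_iff_lt_colLen.1 (ν.up_left_mem le_rfl (Nat.zero_le j) h)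
    omega
  rw [Finset.sum_eq_single_of_mem ⟨SemistandardYoungTableau.highestWeight ν, hb⟩]
  · congr 1
    funext k
    have h := content_eq (SemistandardYoungTableau.highestWeight ν) 0 k
    rw [rightContent_highestWeight] at h
    have h0 : leftContent (SemistandardYoungTableau.highestWeight ν) 0 k = 0 := by
      simp [leftContent]
    simp only
    omega
  · rw [Finset.mem_filter]
    refine ⟨Finset.mem_univ _, ?_⟩
    rintro J k ⟨-, h⟩
    rw [rightContent_highestWeight, rightContent_highestWeight] at h
    simp only at h
    have := ν.rowLen_anti k (k + 1) (by omega)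
    omega
  · intro T hT hne
    exfalso
    apply hne
    apply Subtype.ext
    ext i j
    rw [SemistandardYoungTableau.highestWeight_apply]
    split_ifs with hc
    · exact Good.entry_eq T.2 (Finset.mem_filter.1 hT).2 (ν.rowLen 0) i j (by omega) hc
    · exact T.1.zeros hc

theorem Good.antitone {n : ℕ} {m : ℕ → ℕ} {T : SemistandardYoungTableau ν} (h : Good n m T)
    (i : ℕ) (hi : i + 1 < n) : m (i + 1) + content T (i + 1) ≤ m i + content T i := by
  have h0 (k : ℕ) : leftContent T 0 k = 0 := by simp [leftContent]
  rw [content_eq T 0, content_eq T 0, h0, h0]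
  by_contra hc
  exact h 0 i ⟨hi, by omega⟩

open Classical in
/-- The Littlewood-Richardson rule, in the form of a sum over good tableaux. -/
theorem schurPoly_mul_schurPoly (n : ℕ) (μ ν : YoungDiagram) (hμ : μ.colLen 0 ≤ n) :
    schurPoly n μ * schurPoly n ν =
      ∑ T : {T : BoundedTableau n ν // Good n μ.rowLen T.1},
        schurPoly n (diagramOf n (fun k => μ.rowLen k + content T.1.1 k) T.2.antitone) := by
  apply mul_left_cancel₀ (alt_zero_ne_zero n)
  rw [← mul_assoc, alt_zero_mul_schurPoly n μ hμ, alt_mul_schurPoly,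
    sum_alt_eq n (fun a b h => μ.rowLen_anti a b h), Finset.mul_sum]
  rw [Finset.sum_subtype (p := fun T : BoundedTableau n ν => Good n μ.rowLen T.1) _ (by simp)]
  refine Finset.sum_congr rfl fun T _ => ?_
  rw [alt_zero_mul_schurPoly n _ colLen_diagramOf]
  unfold alt
  congr 1
  ext1 i j
  rw [Matrix.of_apply, Matrix.of_apply, rowLen_diagramOf j.2]

end Positivity

/-- The Schur polynomials `s_λ` in `n` variables, for partitions `λ` of length at most `n`. -/
def schurSet (n : ℕ) : Set (MvPolynomial (Fin n) ℤ) :=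
  {p | ∃ μ : YoungDiagram, μ.colLen 0 ≤ n ∧ p = schurPoly n μ}

/-- A polynomial is Schur positive if it is a linear combination of Schur polynomials with
coefficients in `ℕ`, i.e. a finite sum of Schur polynomials. -/
def IsSchurPositive {n : ℕ} (p : MvPolynomial (Fin n) ℤ) : Prop :=
  p ∈ AddSubmonoid.closure (schurSet n)

theorem schurPoly_bot (n : ℕ) : schurPoly n ⊥ = 1 := by
  have : Unique (BoundedTableau n ⊥) :=
    { default := ⟨default, fun i j h => absurd h (YoungDiagram.notMem_bot _)⟩
      uniq := by
        rintro ⟨T, hT⟩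
        apply Subtype.ext
        ext i j
        rw [T.zeros (YoungDiagram.notMem_bot _),
          SemistandardYoungTableau.zeros _ (YoungDiagram.notMem_bot _)] }
  unfold schurPoly
  rw [Fintype.sum_unique]
  simp [content]

theorem IsSchurPositive.one (n : ℕ) : IsSchurPositive (1 : MvPolynomial (Fin n) ℤ) := by
  apply AddSubmonoid.subset_closure
  refine ⟨⊥, ?_, (schurPoly_bot n).symm⟩
  by_contra hc
  exact YoungDiagram.notMem_bot _ (YoungDiagram.mem_iff_lt_colLen.2
    (show 0 < (⊥ : YoungDiagram).colLen 0 by omega))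

theorem IsSchurPositive.mul {n : ℕ} {p q : MvPolynomial (Fin n) ℤ} (hp : IsSchurPositive p)
    (hq : IsSchurPositive q) : IsSchurPositive (p * q) := by
  unfold IsSchurPositive at *
  induction hp, hq using AddSubmonoid.closure_induction₂ with
  | mem x y hx hy =>
    obtain ⟨μ, hμ, rfl⟩ := hx
    obtain ⟨ν, -, rfl⟩ := hy
    rw [schurPoly_mul_schurPoly n μ ν hμ]
    exact sum_mem fun T _ => AddSubmonoid.subset_closure ⟨_, colLen_diagramOf, rfl⟩
  | zero_left x _ => rw [zero_mul]; exact zero_mem _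
  | zero_right x _ => rw [mul_zero]; exact zero_mem _
  | add_left x y z _ _ _ h1 h2 => rw [add_mul]; exact add_mem h1 h2
  | add_right x y z _ _ _ h1 h2 => rw [mul_add]; exact add_mem h1 h2

/-- The semiring of Schur positive symmetric polynomials in `n` variables with integer
coefficients, as a subsemiring of the polynomial ring. -/
def schurSemiring (n : ℕ) : Subsemiring (MvPolynomial (Fin n) ℤ) where
  carrier := {p | IsSchurPositive p}
  zero_mem' := AddSubmonoid.zero_mem (AddSubmonoid.closure (schurSet n))
  add_mem' := AddSubmonoid.add_mem (AddSubmonoid.closure (schurSet n))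
  one_mem' := IsSchurPositive.one n
  mul_mem' := IsSchurPositive.mul

/-- The preorder on Schur positive polynomials: `p ≤ q` if and only if `q - p` is Schur
positive. -/
instance (n : ℕ) : Preorder (schurSemiring n) where
  le p q := IsSchurPositive (q.1 - p.1)
  le_refl p := by
    rw [sub_self]
    exact AddSubmonoid.zero_mem _
  le_trans p q r h1 h2 := by
    rw [← sub_add_sub_cancel r.1 q.1 p.1]
    exact AddSubmonoid.add_mem _ h2 h1

/-- `schurSemiring n` is a preordered semiring: addition and multiplication are monotone. -/
theorem schurSemiring_le {n : ℕ} {p q : schurSemiring n} (h : p ≤ q) (r : schurSemiring n) :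
    p + r ≤ q + r ∧ p * r ≤ q * r := by
  constructor
  · change IsSchurPositive ((q.1 + r.1) - (p.1 + r.1))
    rw [add_sub_add_right_eq_sub]
    exact h
  · change IsSchurPositive (q.1 * r.1 - p.1 * r.1)
    rw [← sub_mul]
    exact IsSchurPositive.mul h r.2

/-! ### Tropical reals -/

/-- The tropical reals `(ℝ ∪ {-∞}, max, +)`: the semiring addition is `max`, with neutral element
`-∞`, and the semiring multiplication is the addition of `ℝ ∪ {-∞}`, with neutral element the
real number `0`. The order is the usual one, with `-∞` as the least element. -/
def TropicalReal : Type := WithBot ℝ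

namespace TropicalReal

noncomputable instance : LinearOrder TropicalReal := inferInstanceAs (LinearOrder (WithBot ℝ))

instance : OrderBot TropicalReal := inferInstanceAs (OrderBot (WithBot ℝ))

/-- The inclusion of the real numbers. -/
def ofReal (r : ℝ) : TropicalReal := (r : WithBot ℝ)

instance : Zero TropicalReal := ⟨(⊥ : WithBot ℝ)⟩

instance : One TropicalReal := ⟨ofReal 0⟩

noncomputable instance : Add TropicalReal := ⟨fun a b => max a b⟩

/-- Multiplication of tropical reals is the addition of `ℝ ∪ {-∞}`, where `-∞` is absorbing. -/
noncomputable instance : Mul TropicalReal :=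
  ⟨fun a b => (show WithBot ℝ from (show WithBot ℝ from a) + (show WithBot ℝ from b))⟩

noncomputable instance : CommSemiring TropicalReal where
  nsmul := nsmulRec
  add_assoc a b c := max_assoc a b c
  zero_add a := max_eq_right (bot_le (α := WithBot ℝ))
  add_zero a := max_eq_left (bot_le (α := WithBot ℝ))
  add_comm a b := max_comm a b
  mul_assoc a b c := add_assoc (G := WithBot ℝ) a b c
  mul_comm a b := add_comm (G := WithBot ℝ) a b
  one_mul a := zero_add (M := WithBot ℝ) a
  mul_one a := add_zero (M := WithBot ℝ) a
  zero_mul a := WithBot.bot_add a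
  mul_zero a := WithBot.add_bot a
  left_distrib a b c := (max_add_add_left (α := WithBot ℝ) a b c).symm
  right_distrib a b c := (max_add_add_right (α := WithBot ℝ) a b c).symm

end TropicalReal

/-- The maximum of `⟨α, y⟩ = ∑ i, α i * y i` over the monomials `x ^ α` that occur in `p`; it is
`-∞` for `p = 0`. -/
noncomputable def maxMonomial {n : ℕ} (y : Fin n → ℝ) (p : MvPolynomial (Fin n) ℤ) :
    TropicalReal :=
  p.support.sup fun α => TropicalReal.ofReal (∑ i, (α i : ℝ) * y i)

/-- The Newton polytope of `p`: the convex hull of the exponents of the monomials of `p`. -/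
def newtonPolytope {n : ℕ} (p : MvPolynomial (Fin n) ℤ) : Set (Fin n → ℝ) :=
  convexHull ℝ ((fun (α : Fin n →₀ ℕ) (i : Fin n) => (α i : ℝ)) '' (p.support : Set (Fin n →₀ ℕ)))

end SchurTrop

/-!
That `maxMonomial y` is a homomorphism on the Schur positive polynomials is due to the absence of
cancellation: the coefficients are nonnegative, so supports of sums and products are unions and
Minkowski sums (`maxMonomial_add`, `maxMonomial_mul`). A linear function has the same maximum on a
finite set and on its convex hull (`isGreatest_maxMonomial`).

Conversely, let `ψ` be a homomorphism with trivial kernel, and write `f μ` for the real number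
`ψ (s_μ)`. The Littlewood-Richardson rule says that `f μ + f κ` is the maximum of `f ν` over the
`s_ν` that occur in `s_μ * s_κ`; these properties are collected in `IsSchurWeight`. Let `y i` be
`ψ (e_(i+1)) - ψ (e_i)`, so that the product of the elementary symmetric polynomials `e_h` over the
columns of `μ` has the value `⟨μ, y⟩ = ∑ i, μ i * y i`. The claim is `f μ = ⟨μ, y⟩`
(`IsSchurWeight.eq_sum`).

* The sequence `y` is antitone, because every Schur polynomial in `e_(k+2) * e_k` occurs in
  `e_(k+1) ^ 2` (`IsSchurWeight.columnIncrement_succ_le`).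
* `f μ ≤ ⟨μ, y⟩`, because `s_μ` occurs in the product of the `e_h`. Moreover `⟨μ, y⟩ = f ν` for
  some `ν` that is dominated by `μ` (`IsSchurWeight.exists_dominated`).
* If `μ` is constant on the blocks where `y` is constant, such a `ν` has to be `μ` itself: from
  `⟨ν, y⟩ = ⟨μ, y⟩`, summation by parts shows that the partial sums agree at the ends of the blocks,
  and within a block a discrete maximum principle applies (`Dominated.eq_of_sum_mul_eq`). Hence
  `f μ = ⟨μ, y⟩` for these `μ`.
* For general `κ`, reverse `κ` within each block to obtain `L`, and choose `C` constant on blocks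
  such that `C - L` is a partition. The key tableau with content `L` (`keyTableau`) shows that `s_C`
  occurs in `s_(C-L) * s_κ`. So `⟨C, y⟩ = f C ≤ f (C - L) + f κ ≤ ⟨C, y⟩ - ⟨L, y⟩ + f κ`, and
  `⟨L, y⟩ = ⟨κ, y⟩`.

Finally `maxMonomial y (s_μ) = ⟨μ, y⟩` for antitone `y`, since contents of tableaux of shape `μ` are
dominated by `μ` (`maxMonomial_schurPoly`), and homomorphisms are determined by their values on the
Schur polynomials.
-/

namespace SchurTrop

open MvPolynomial

/-! ### Tropical reals -/

namespace TropicalReal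

theorem ofReal_mul (a b : ℝ) : ofReal a * ofReal b = ofReal (a + b) := rfl

theorem ofReal_le {a b : ℝ} : ofReal a ≤ ofReal b ↔ a ≤ b := WithBot.coe_le_coe

theorem ofReal_injective : Function.Injective ofReal := WithBot.coe_injective

theorem ofReal_ne_zero (a : ℝ) : ofReal a ≠ 0 := WithBot.coe_ne_bot

theorem add_eq_max (a b : TropicalReal) : a + b = max a b := rfl

theorem exists_eq_ofReal {a : TropicalReal} (h : a ≠ 0) : ∃ r, a = ofReal r := by
  obtain ⟨r, hr⟩ := WithBot.ne_bot_iff_exists.1 h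
  exact ⟨r, hr.symm⟩

theorem mul_le_mul_of_le {a b c d : TropicalReal} (h : a ≤ b) (h' : c ≤ d) : a * c ≤ b * d :=
  add_le_add (α := WithBot ℝ) h h'

theorem sum_eq_sup {ι : Type*} (s : Finset ι) (g : ι → TropicalReal) :
    ∑ i ∈ s, g i = s.sup g := by
  classical
  induction s using Finset.induction_on with
  | empty => rfl
  | insert a s ha ih => rw [Finset.sum_insert ha, Finset.sup_insert, ih]; rfl

end TropicalReal

open TropicalReal

/-! ### The support of polynomials with nonnegative coefficients -/

section Nonneg

variable {n : ℕ} {p q : MvPolynomial (Fin n) ℤ}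

theorem schurPoly_eq_sum_monomial (n : ℕ) (μ : YoungDiagram) :
    schurPoly n μ = ∑ T : BoundedTableau n μ,
      monomial (Finsupp.equivFunOnFinite.symm fun k : Fin n => content T.1 k) 1 := by
  refine Finset.sum_congr rfl fun T _ => ?_
  rw [monomial_eq, Finsupp.prod_fintype _ _ (fun i => pow_zero _)]
  simp

theorem coeff_schurPoly_nonneg (n : ℕ) (μ : YoungDiagram) (α : Fin n →₀ ℕ) :
    0 ≤ coeff α (schurPoly n μ) := by
  rw [schurPoly_eq_sum_monomial, coeff_sum]
  refine Finset.sum_nonneg fun T _ => ?_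
  rw [coeff_monomial]
  split_ifs <;> simp

theorem mem_support_schurPoly {n : ℕ} {μ : YoungDiagram} {α : Fin n →₀ ℕ} :
    α ∈ (schurPoly n μ).support ↔
      ∃ T : BoundedTableau n μ, ∀ k : Fin n, α k = content T.1 k := by
  classical
  have hT (T : BoundedTableau n μ) :
      (Finsupp.equivFunOnFinite.symm fun k : Fin n => content T.1 k) = α ↔
        ∀ k : Fin n, α k = content T.1 k := by
    rw [Finsupp.ext_iff]
    exact forall_congr' fun k => eq_comm
  rw [mem_support_iff, schurPoly_eq_sum_monomial, coeff_sum, ne_eq,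
    Finset.sum_eq_zero_iff_of_nonneg]
  · simp only [Finset.mem_univ, true_implies, coeff_monomial, hT]
    push Not
    exact exists_congr fun T => by split_ifs with h <;> simp [h]
  · intro T _
    rw [coeff_monomial]
    split_ifs <;> simp

theorem IsSchurPositive.coeff_nonneg (hp : IsSchurPositive p) (α : Fin n →₀ ℕ) :
    0 ≤ coeff α p := by
  induction hp using AddSubmonoid.closure_induction with
  | mem x hx =>
    obtain ⟨μ, -, rfl⟩ := hx
    exact coeff_schurPoly_nonneg n μ α
  | zero => simp
  | add x y _ _ hx hy => rw [coeff_add]; exact add_nonneg hx hy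

theorem support_add_of_nonneg (hp : ∀ α, 0 ≤ coeff α p) (hq : ∀ α, 0 ≤ coeff α q) :
    (p + q).support = p.support ∪ q.support := by
  ext α
  simp only [mem_support_iff, Finset.mem_union, coeff_add]
  have := hp α
  have := hq α
  omega

theorem add_mem_support_mul_of_nonneg (hp : ∀ α, 0 ≤ coeff α p) (hq : ∀ α, 0 ≤ coeff α q)
    {α β : Fin n →₀ ℕ} (hα : α ∈ p.support) (hβ : β ∈ q.support) :
    α + β ∈ (p * q).support := by
  classical
  rw [mem_support_iff] at *
  rw [coeff_mul]
  refine (Finset.sum_pos' (fun x _ => mul_nonneg (hp _) (hq _)) ⟨(α, β), by simp, ?_⟩).ne'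
  exact mul_pos ((hp α).lt_of_ne' hα) ((hq β).lt_of_ne' hβ)

end Nonneg

/-! ### Maxima of linear functions over supports -/

section MaxMonomial

variable {n : ℕ} {p q : MvPolynomial (Fin n) ℤ} (y : Fin n → ℝ)

theorem maxMonomial_zero : maxMonomial y 0 = 0 := rfl

theorem exists_maxMonomial_eq (hp : p ≠ 0) :
    ∃ α ∈ p.support, maxMonomial y p = ofReal (∑ i, (α i : ℝ) * y i) :=
  Finset.exists_mem_eq_sup _ (support_nonempty.2 hp) _

theorem le_maxMonomial {α : Fin n →₀ ℕ} (h : α ∈ p.support) :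
    ofReal (∑ i, (α i : ℝ) * y i) ≤ maxMonomial y p :=
  Finset.le_sup (f := fun α : Fin n →₀ ℕ => ofReal (∑ i, (α i : ℝ) * y i)) h

theorem maxMonomial_eq_zero : maxMonomial y p = 0 ↔ p = 0 := by
  refine ⟨fun h => ?_, fun h => by rw [h, maxMonomial_zero]⟩
  by_contra hp
  obtain ⟨α, -, hα⟩ := exists_maxMonomial_eq y hp
  exact ofReal_ne_zero _ (hα.symm.trans h)

theorem maxMonomial_one : maxMonomial y (1 : MvPolynomial (Fin n) ℤ) = 1 := by
  classical
  obtain ⟨α, hα, h⟩ := exists_maxMonomial_eq y (one_ne_zero (α := MvPolynomial (Fin n) ℤ))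
  rw [mem_support_iff, coeff_one] at hα
  have h0 : α = 0 := by
    by_contra hne
    exact hα (if_neg (Ne.symm hne))
  rw [h, h0]
  simp only [Finsupp.coe_zero, Pi.zero_apply, Nat.cast_zero, zero_mul, Finset.sum_const_zero]
  rfl

theorem maxMonomial_add (hp : ∀ α, 0 ≤ coeff α p) (hq : ∀ α, 0 ≤ coeff α q) :
    maxMonomial y (p + q) = maxMonomial y p + maxMonomial y q := by
  classical
  unfold maxMonomial
  rw [support_add_of_nonneg hp hq, Finset.sup_union]
  rfl

theorem maxMonomial_mul (hp : ∀ α, 0 ≤ coeff α p) (hq : ∀ α, 0 ≤ coeff α q) :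
    maxMonomial y (p * q) = maxMonomial y p * maxMonomial y q := by
  classical
  by_cases hp0 : p = 0
  · rw [hp0, zero_mul, maxMonomial_zero, zero_mul]
  by_cases hq0 : q = 0
  · rw [hq0, mul_zero, maxMonomial_zero, mul_zero]
  have hadd (α β : Fin n →₀ ℕ) : ofReal (∑ i, ((α + β) i : ℝ) * y i) =
      ofReal (∑ i, (α i : ℝ) * y i) * ofReal (∑ i, (β i : ℝ) * y i) := by
    rw [ofReal_mul, ← Finset.sum_add_distrib]
    congr 1
    refine Finset.sum_congr rfl fun i _ => ?_
    rw [Finsupp.add_apply, Nat.cast_add, add_mul]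
  apply le_antisymm
  · refine Finset.sup_le fun γ hγ => ?_
    obtain ⟨α, hα, β, hβ, rfl⟩ := Finset.mem_add.1 (support_mul p q hγ)
    rw [hadd]
    exact mul_le_mul_of_le (le_maxMonomial y hα) (le_maxMonomial y hβ)
  · obtain ⟨α, hα, h1⟩ := exists_maxMonomial_eq y hp0
    obtain ⟨β, hβ, h2⟩ := exists_maxMonomial_eq y hq0
    rw [h1, h2, ← hadd]
    exact le_maxMonomial y (add_mem_support_mul_of_nonneg hp hq hα hβ)

/-- `maxMonomial y` as a monotone homomorphism on the Schur positive polynomials. Multiplicativity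
needs nonnegative coefficients: there no cancellation occurs in sums and products. -/
noncomputable def maxMonomialHom (y : Fin n → ℝ) : schurSemiring n →+*o TropicalReal where
  toFun p := maxMonomial y p.1
  map_one' := maxMonomial_one y
  map_mul' p q := maxMonomial_mul y (IsSchurPositive.coeff_nonneg p.2)
    (IsSchurPositive.coeff_nonneg q.2)
  map_zero' := maxMonomial_zero y
  map_add' p q := maxMonomial_add y (IsSchurPositive.coeff_nonneg p.2)
    (IsSchurPositive.coeff_nonneg q.2)
  monotone' p q h := by
    have h1 := maxMonomial_add y (IsSchurPositive.coeff_nonneg p.2)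
      (IsSchurPositive.coeff_nonneg (show IsSchurPositive (q.1 - p.1) from h))
    rw [add_sub_cancel] at h1
    change maxMonomial y p.1 ≤ maxMonomial y q.1
    rw [h1, add_eq_max]
    exact le_max_left _ _

theorem isGreatest_maxMonomial (hp : p ≠ 0) :
    IsGreatest ((fun v : Fin n → ℝ => ofReal (∑ i, v i * y i)) '' newtonPolytope p)
      (maxMonomial y p) := by
  obtain ⟨α, hα, h⟩ := exists_maxMonomial_eq y hp
  refine ⟨⟨fun i => (α i : ℝ), subset_convexHull ℝ _ ⟨α, hα, rfl⟩, h.symm⟩, ?_⟩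
  rintro _ ⟨v, hv, rfl⟩
  rw [h]
  refine ofReal_le.2 ?_
  -- a half-space that contains all the exponents contains their convex hull
  have hconv : Convex ℝ {v : Fin n → ℝ | ∑ i, v i * y i ≤ ∑ i, (α i : ℝ) * y i} :=
    convex_halfSpace_le
      ⟨fun a b => by simp only [Pi.add_apply, add_mul, Finset.sum_add_distrib],
        fun c a => by simp only [Pi.smul_apply, smul_eq_mul, mul_assoc, Finset.mul_sum]⟩ _
  refine convexHull_min ?_ hconv hv
  rintro _ ⟨β, hβ, rfl⟩
  have := le_maxMonomial y hβ
  rw [h] at this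
  exact ofReal_le.1 this

end MaxMonomial

/-! ### Contents of tableaux -/

section Content

variable {μ : YoungDiagram}

theorem rowLen_eq_zero {n i : ℕ} (hμ : μ.colLen 0 ≤ n) (hi : n ≤ i) : μ.rowLen i = 0 := by
  by_contra h
  have := YoungDiagram.mem_iff_lt_colLen.1
    (YoungDiagram.mem_iff_lt_rowLen.2 (Nat.pos_of_ne_zero h))
  omega

theorem youngDiagram_ext_rowLen {ν : YoungDiagram} {n : ℕ} (hμ : μ.colLen 0 ≤ n)
    (hν : ν.colLen 0 ≤ n) (h : ∀ i, i < n → μ.rowLen i = ν.rowLen i) : μ = ν := by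
  apply SetLike.ext
  rintro ⟨i, j⟩
  rw [YoungDiagram.mem_iff_lt_rowLen, YoungDiagram.mem_iff_lt_rowLen]
  rcases lt_or_ge i n with hi | hi
  · rw [h i hi]
  · rw [rowLen_eq_zero hμ hi, rowLen_eq_zero hν hi]

theorem card_lt_rowLen {n : ℕ} (hμ : μ.colLen 0 ≤ n) (j : ℕ) :
    ((Finset.range n).filter fun k => j < μ.rowLen k).card = μ.colLen j := by
  rw [← Finset.card_range (μ.colLen j)]
  congr 1
  ext k
  rw [Finset.mem_filter, Finset.mem_range, Finset.mem_range, ← YoungDiagram.mem_iff_lt_rowLen,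
    YoungDiagram.mem_iff_lt_colLen, and_iff_right_iff_imp]
  intro hk
  have := μ.colLen_anti 0 j (Nat.zero_le j)
  omega

theorem sum_content (T : SemistandardYoungTableau μ) (j : ℕ) :
    ∑ k ∈ Finset.range j, content T k = (μ.cells.filter fun c => T c.1 c.2 < j).card := by
  rw [Finset.card_eq_sum_card_fiberwise (f := fun c => T c.1 c.2) (t := Finset.range j)]
  · refine Finset.sum_congr rfl fun k hk => ?_
    rw [Finset.mem_range] at hk
    unfold content
    congr 1
    ext c
    simp only [Finset.mem_filter]
    constructor
    · rintro ⟨h1, h2⟩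
      exact ⟨⟨h1, by omega⟩, h2⟩
    · rintro ⟨⟨h1, -⟩, h2⟩
      exact ⟨h1, h2⟩
  · intro c hc
    simpa using (Finset.mem_filter.1 hc).2

theorem content_highestWeight (μ : YoungDiagram) (k : ℕ) :
    content (SemistandardYoungTableau.highestWeight μ) k = μ.rowLen k := by
  have h := rightContent_highestWeight μ 0 k
  rw [Nat.sub_zero] at h
  rw [← h]
  simp [content, rightContent]

theorem sum_rowLen (μ : YoungDiagram) (j : ℕ) :
    ∑ k ∈ Finset.range j, μ.rowLen k = (μ.cells.filter fun c => c.1 < j).card := by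
  simp_rw [← content_highestWeight]
  rw [sum_content]
  congr 1
  apply Finset.filter_congr
  rintro ⟨a, b⟩ hc
  rw [SemistandardYoungTableau.highestWeight_apply, if_pos (YoungDiagram.mem_cells _ |>.1 hc)]

/-- The content of a tableau is dominated by its shape: an entry `k` lies in one of the rows
`0, …, k`. -/
theorem sum_content_le (T : SemistandardYoungTableau μ) (j : ℕ) :
    ∑ k ∈ Finset.range j, content T k ≤ ∑ k ∈ Finset.range j, μ.rowLen k := by
  rw [sum_content, sum_rowLen]
  refine Finset.card_le_card (Finset.monotone_filter_right _ fun c hc h => ?_)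
  exact (le_entry T c.1 c.2 hc).trans_lt h

theorem sum_content_eq {n : ℕ} (hμ : μ.colLen 0 ≤ n) (T : BoundedTableau n μ) :
    ∑ k ∈ Finset.range n, content T.1 k = ∑ k ∈ Finset.range n, μ.rowLen k := by
  rw [sum_content, sum_rowLen]
  congr 1
  apply Finset.filter_congr
  rintro ⟨a, b⟩ hc
  have h1 := T.2 a b hc
  have h2 : (a, b) ∈ μ := hc
  have := YoungDiagram.mem_iff_lt_colLen.1 (μ.up_left_mem le_rfl (Nat.zero_le b) h2)
  simp only
  omega

/-- The highest weight tableau, with entries bounded by the number of rows. -/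
def boundedHighestWeight {n : ℕ} (hμ : μ.colLen 0 ≤ n) : BoundedTableau n μ :=
  ⟨SemistandardYoungTableau.highestWeight μ, fun i j h => by
    rw [SemistandardYoungTableau.highestWeight_apply, if_pos h]
    have := YoungDiagram.mem_iff_lt_colLen.1 (μ.up_left_mem le_rfl (Nat.zero_le j) h)
    omega⟩

end Content

/-! ### Key tableaux -/

section Key

variable {μ : YoungDiagram} {n : ℕ} {L : ℕ → ℕ}

theorem lt_card_of_mem (hμ : μ.colLen 0 ≤ n)
    (hL : ∀ j, ((Finset.range n).filter fun k => j < L k).card =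
      ((Finset.range n).filter fun k => j < μ.rowLen k).card) {i j : ℕ} (h : (i, j) ∈ μ)
    (hf : (Set.ofPred fun k => k < n ∧ j < L k).Finite) : i < hf.toFinset.card := by
  have h1 := YoungDiagram.mem_iff_lt_colLen.1 h
  rw [← card_lt_rowLen hμ, ← hL] at h1
  convert h1 using 2
  ext k
  simp

/-- The key tableau of shape `μ` whose content is a rearrangement `L` of the row lengths of `μ`:
column `j` consists of the `k < n` with `j < L k`, in increasing order. -/
noncomputable def keyTableau (hμ : μ.colLen 0 ≤ n)
    (hL : ∀ j, ((Finset.range n).filter fun k => j < L k).card =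
      ((Finset.range n).filter fun k => j < μ.rowLen k).card) : SemistandardYoungTableau μ where
  entry i j := open Classical in
    if (i, j) ∈ μ then Nat.nth (fun k => k < n ∧ j < L k) i else 0
  row_weak' := by
    classical
    intro i j1 j2 hj hc
    have hc1 : (i, j1) ∈ μ := μ.up_left_mem le_rfl hj.le hc
    rw [if_pos hc, if_pos hc1]
    have h1 := lt_card_of_mem hμ hL hc1
    have h2 := lt_card_of_mem hμ hL hc
    have h3 := Nat.nth_mem i h2
    have h4 := Nat.count_nth h2
    -- the set for `j2` is contained in the one for `j1`, so its `i`-th element is larger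
    have h5 : Nat.count (fun k => k < n ∧ j2 < L k) (Nat.nth (fun k => k < n ∧ j2 < L k) i) ≤
        Nat.count (fun k => k < n ∧ j1 < L k) (Nat.nth (fun k => k < n ∧ j2 < L k) i) :=
      Nat.count_mono_left fun k _ hk => ⟨hk.1, by omega⟩
    have h6 : Nat.nth (fun k => k < n ∧ j1 < L k) (Nat.count (fun k => k < n ∧ j1 < L k)
        (Nat.nth (fun k => k < n ∧ j2 < L k) i)) = Nat.nth (fun k => k < n ∧ j2 < L k) i :=
      Nat.nth_count (p := fun k => k < n ∧ j1 < L k) ⟨h3.1, by omega⟩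
    rw [← h6]
    refine Nat.nth_le_nth' (by omega) fun hf => ?_
    exact Nat.count_lt_card hf ⟨h3.1, by omega⟩
  col_strict' := by
    classical
    intro i1 i2 j hi hc
    rw [if_pos hc, if_pos (μ.up_left_mem hi.le le_rfl hc)]
    exact Nat.nth_lt_nth' hi (lt_card_of_mem hμ hL hc)
  zeros' := by
    intro i j hc
    rw [if_neg hc]

variable {hμ : μ.colLen 0 ≤ n}
  {hL : ∀ j, ((Finset.range n).filter fun k => j < L k).card =
      ((Finset.range n).filter fun k => j < μ.rowLen k).card}

theorem keyTableau_apply {i j : ℕ} (h : (i, j) ∈ μ) :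
    keyTableau hμ hL i j = Nat.nth (fun k => k < n ∧ j < L k) i := if_pos h

theorem keyTableau_mem {i j : ℕ} (h : (i, j) ∈ μ) :
    keyTableau hμ hL i j < n ∧ j < L (keyTableau hμ hL i j) := by
  rw [keyTableau_apply h]
  exact Nat.nth_mem i (lt_card_of_mem hμ hL h)

theorem exists_keyTableau_eq {j k : ℕ} (hk : k < n) (hj : j < L k) :
    ∃ i, (i, j) ∈ μ ∧ keyTableau hμ hL i j = k := by
  classical
  have hf : (Set.ofPred fun k => k < n ∧ j < L k).Finite :=
    (Set.finite_lt_nat n).subset fun k hk => hk.1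
  have h1 : Nat.count (fun k => k < n ∧ j < L k) k < hf.toFinset.card :=
    Nat.count_lt_card hf ⟨hk, hj⟩
  have h2 : (Nat.count (fun k => k < n ∧ j < L k) k, j) ∈ μ := by
    rw [YoungDiagram.mem_iff_lt_colLen, ← card_lt_rowLen hμ, ← hL]
    convert h1 using 2
    ext k
    simp
  refine ⟨_, h2, ?_⟩
  rw [keyTableau_apply h2]
  exact Nat.nth_count (p := fun k => k < n ∧ j < L k) ⟨hk, hj⟩

theorem rightContent_keyTableau {k : ℕ} (hk : k < n) (J : ℕ) :
    rightContent (keyTableau hμ hL) J k = L k - J := by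
  unfold rightContent
  rw [← Nat.card_Ico]
  refine Finset.card_bij (fun c _ => c.2) ?_ ?_ ?_
  · rintro ⟨i, j⟩ h
    simp only [Finset.mem_filter, YoungDiagram.mem_cells] at h
    obtain ⟨hc, hJ, rfl⟩ := h
    exact Finset.mem_Ico.2 ⟨hJ, (keyTableau_mem hc).2⟩
  · rintro ⟨i, j⟩ h ⟨i', j'⟩ h' he
    simp only [Finset.mem_filter, YoungDiagram.mem_cells] at h h' he
    subst he
    rcases lt_trichotomy i i' with hl | hl | hl
    · have := (keyTableau hμ hL).col_strict hl h'.1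
      omega
    · rw [hl]
    · have := (keyTableau hμ hL).col_strict hl h.1
      omega
  · intro j hj
    rw [Finset.mem_Ico] at hj
    obtain ⟨i, hi, h⟩ := exists_keyTableau_eq (hμ := hμ) (hL := hL) hk hj.2
    exact ⟨(i, j), by simp [hi, h, hj.1], rfl⟩

theorem content_keyTableau {k : ℕ} (hk : k < n) : content (keyTableau hμ hL) k = L k := by
  have h := rightContent_keyTableau (hμ := hμ) (hL := hL) hk 0
  rw [Nat.sub_zero] at h
  rw [← h]
  simp [content, rightContent]

end Key

/-! ### Columns -/

/-- The Young diagram with a single column of length `h`. -/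
def column (h : ℕ) : YoungDiagram := diagramOf h (fun _ => 1) fun _ _ => le_rfl

theorem colLen_column (h : ℕ) : (column h).colLen 0 ≤ h := colLen_diagramOf

theorem rowLen_column (h i : ℕ) : (column h).rowLen i = if i < h then 1 else 0 := by
  split_ifs with hi
  · exact rowLen_diagramOf hi
  · exact rowLen_eq_zero (colLen_column h) (by omega)

theorem content_column_le_one {h : ℕ} (T : SemistandardYoungTableau (column h)) (k : ℕ) :
    content T k ≤ 1 := by
  refine le_trans (Finset.card_le_card ?_) (card_col_le_one T 0 k)
  rintro ⟨i, j⟩ hc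
  simp only [Finset.mem_filter, YoungDiagram.mem_cells] at hc ⊢
  have h1 := YoungDiagram.mem_iff_lt_rowLen.1 hc.1
  rw [rowLen_column] at h1
  split_ifs at h1 with h2
  · exact ⟨hc.1, by omega, hc.2⟩
  · omega

/-- Induction on Young diagrams with at most `n` rows by adding columns, tallest last. -/
theorem column_induction {n : ℕ} {P : YoungDiagram → Prop} (bot : P ⊥)
    (add : ∀ (μ ν : YoungDiagram) (h : ℕ), μ.colLen 0 ≤ n → ν.colLen 0 ≤ n → h ≤ n → P μ →
      (∀ i, ν.rowLen i = μ.rowLen i + (column h).rowLen i) → P ν)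
    (ν : YoungDiagram) (hν : ν.colLen 0 ≤ n) : P ν := by
  induction hm : ν.rowLen 0 generalizing ν with
  | zero =>
    convert bot
    apply SetLike.ext
    rintro ⟨i, j⟩
    have := ν.rowLen_anti 0 i (Nat.zero_le i)
    refine iff_of_false (fun h => ?_) (YoungDiagram.notMem_bot _)
    rw [YoungDiagram.mem_iff_lt_rowLen] at h
    omega
  | succ m ih =>
    have hμ (i : ℕ) : (diagramOf n (fun i => ν.rowLen i - 1) fun i _ => by
        have := ν.rowLen_anti i (i + 1) (by omega)
        omega).rowLen i = ν.rowLen i - 1 := by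
      rcases lt_or_ge i n with hi | hi
      · exact rowLen_diagramOf hi
      · rw [rowLen_eq_zero colLen_diagramOf hi, rowLen_eq_zero hν hi]
    refine add _ ν (ν.colLen 0) colLen_diagramOf hν hν
      (ih _ colLen_diagramOf (by rw [hμ]; omega)) fun i => ?_
    rw [hμ, rowLen_column]
    have h1 : 0 < ν.rowLen i ↔ i < ν.colLen 0 := by
      rw [← YoungDiagram.mem_iff_lt_rowLen, ← YoungDiagram.mem_iff_lt_colLen]
    split_ifs <;> omega

/-! ### Dominance -/

section Dominance

/-- Dominance of sequences of length `n`: the partial sums of `ν` are at most those of `μ`, and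
the total sums agree. -/
def Dominated (n : ℕ) (ν μ : ℕ → ℕ) : Prop :=
  (∀ j, j ≤ n → ∑ i ∈ Finset.range j, ν i ≤ ∑ i ∈ Finset.range j, μ i) ∧
    ∑ i ∈ Finset.range n, ν i = ∑ i ∈ Finset.range n, μ i

theorem Dominated.refl (n : ℕ) (μ : ℕ → ℕ) : Dominated n μ μ := ⟨fun _ _ => le_rfl, rfl⟩

theorem Dominated.add {n : ℕ} {ν μ ν' μ' : ℕ → ℕ} (h : Dominated n ν μ)
    (h' : Dominated n ν' μ') : Dominated n (fun i => ν i + ν' i) fun i => μ i + μ' i := by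
  constructor
  · intro j hj
    rw [Finset.sum_add_distrib, Finset.sum_add_distrib]
    exact add_le_add (h.1 j hj) (h'.1 j hj)
  · rw [Finset.sum_add_distrib, Finset.sum_add_distrib, h.2, h'.2]

theorem dominated_content {n : ℕ} {μ : YoungDiagram} (hμ : μ.colLen 0 ≤ n)
    (T : BoundedTableau n μ) : Dominated n (content T.1) μ.rowLen :=
  ⟨fun j _ => sum_content_le T.1 j, sum_content_eq hμ T⟩

theorem Dominated.congr {n : ℕ} {ν μ ν' μ' : ℕ → ℕ} (h : Dominated n ν μ)
    (hν : ∀ i, i < n → ν' i = ν i) (hμ : ∀ i, i < n → μ' i = μ i) : Dominated n ν' μ' := by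
  have hs {a b : ℕ → ℕ} (hab : ∀ i, i < n → a i = b i) (j : ℕ) (hj : j ≤ n) :
      ∑ i ∈ Finset.range j, a i = ∑ i ∈ Finset.range j, b i :=
    Finset.sum_congr rfl fun i hi => hab i ((Finset.mem_range.1 hi).trans_le hj)
  constructor
  · intro j hj
    rw [hs hν j hj, hs hμ j hj]
    exact h.1 j hj
  · rw [hs hν n le_rfl, hs hμ n le_rfl, h.2]

/-- Summation by parts. -/
theorem sum_range_succ_mul_eq (d y : ℕ → ℝ) (n : ℕ) :
    ∑ i ∈ Finset.range (n + 1), d i * y i = (∑ i ∈ Finset.range (n + 1), d i) * y n +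
      ∑ j ∈ Finset.range n, (∑ i ∈ Finset.range (j + 1), d i) * (y j - y (j + 1)) := by
  induction n with
  | zero => simp
  | succ n ih =>
    rw [Finset.sum_range_succ, ih, Finset.sum_range_succ (fun j => _ * _) n,
      Finset.sum_range_succ d (n + 1)]
    ring

variable {n : ℕ} {ν μ : ℕ → ℕ} {y : ℕ → ℝ}

theorem Dominated.sub_eq (h : Dominated (n + 1) ν μ) :
    ∑ i ∈ Finset.range (n + 1), (μ i : ℝ) * y i - ∑ i ∈ Finset.range (n + 1), (ν i : ℝ) * y i =
      ∑ j ∈ Finset.range n,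
        (∑ i ∈ Finset.range (j + 1), ((μ i : ℝ) - ν i)) * (y j - y (j + 1)) := by
  have h0 : ∑ i ∈ Finset.range (n + 1), ((μ i : ℝ) - ν i) = 0 := by
    rw [Finset.sum_sub_distrib, sub_eq_zero]
    exact_mod_cast h.2.symm
  rw [← Finset.sum_sub_distrib]
  simp_rw [← sub_mul]
  rw [sum_range_succ_mul_eq, h0, zero_mul, zero_add]

theorem Dominated.partial_sum_nonneg (h : Dominated n ν μ) {j : ℕ} (hj : j ≤ n) :
    0 ≤ ∑ i ∈ Finset.range j, ((μ i : ℝ) - ν i) := by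
  rw [Finset.sum_sub_distrib, sub_nonneg]
  exact_mod_cast h.1 j hj

theorem Dominated.sum_mul_le (h : Dominated n ν μ) (hy : ∀ i, i + 1 < n → y (i + 1) ≤ y i) :
    ∑ i ∈ Finset.range n, (ν i : ℝ) * y i ≤ ∑ i ∈ Finset.range n, (μ i : ℝ) * y i := by
  cases n with
  | zero => simp
  | succ n =>
    rw [← sub_nonneg, h.sub_eq]
    refine Finset.sum_nonneg fun j hj => ?_
    rw [Finset.mem_range] at hj
    have := hy j (by omega)
    refine mul_nonneg (h.partial_sum_nonneg (by omega)) ?_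
    linarith

/-- The discrete maximum principle: a sequence that is convex wherever it is positive, and not
positive at the ends, is nowhere positive. -/
theorem nonpos_of_convex_of_pos {D : ℕ → ℝ} (h0 : D 0 ≤ 0) (hn : D n ≤ 0)
    (h : ∀ j, j + 1 < n → D (j + 1) ≤ 0 ∨ 2 * D (j + 1) ≤ D j + D (j + 2)) :
    ∀ j, j ≤ n → D j ≤ 0 := by
  classical
  by_contra! hc
  -- after the first positive value the sequence has to increase for ever
  obtain ⟨hj1, hj2⟩ := Nat.find_spec hc
  obtain ⟨i, hi⟩ : ∃ i, Nat.find hc = i + 1 := by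
    refine ⟨Nat.find hc - 1, ?_⟩
    have : Nat.find hc ≠ 0 := by
      intro h1
      rw [h1] at hj2
      linarith
    omega
  rw [hi] at hj1 hj2
  have hmin : D i ≤ 0 := by
    have := Nat.find_min hc (m := i) (by omega)
    push Not at this
    exact this (by omega)
  have key : ∀ t, i + t + 1 ≤ n → 0 < D (i + t + 1) ∧ D (i + t) < D (i + t + 1) := by
    intro t
    induction t with
    | zero => exact fun _ => ⟨hj2, by simpa using hmin.trans_lt hj2⟩
    | succ t ih =>
      intro ht
      obtain ⟨h1, h2⟩ := ih (by omega)
      have h3 : 2 * D (i + t + 1) ≤ D (i + t) + D (i + (t + 1) + 1) :=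
        (h (i + t) (by omega)).resolve_left (by linarith)
      change _ ∧ D (i + t + 1) < _
      constructor <;> linarith
  have := (key (n - i - 1) (by omega)).1
  rw [show i + (n - i - 1) + 1 = n by omega] at this
  linarith

/-- Equality in `Dominated.sum_mul_le` is rigid if the larger sequence is constant wherever `y`
is: the difference `D` of the partial sums vanishes where `y` drops, and is convex elsewhere. -/
theorem Dominated.eq_of_sum_mul_eq (h : Dominated n ν μ)
    (hy : ∀ i, i + 1 < n → y (i + 1) ≤ y i) (hν : ∀ i, i + 1 < n → ν (i + 1) ≤ ν i)
    (hμ : ∀ i, i + 1 < n → y (i + 1) = y i → μ (i + 1) = μ i)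
    (heq : ∑ i ∈ Finset.range n, (ν i : ℝ) * y i = ∑ i ∈ Finset.range n, (μ i : ℝ) * y i) :
    ∀ i, i < n → ν i = μ i := by
  cases n with
  | zero => intro i hi; omega
  | succ n =>
    have hsum := h.sub_eq (y := y)
    rw [heq, sub_self, eq_comm, Finset.sum_eq_zero_iff_of_nonneg] at hsum
    swap
    · intro j hj
      rw [Finset.mem_range] at hj
      have := hy j (by omega)
      exact mul_nonneg (h.partial_sum_nonneg (by omega)) (by linarith)
    have hD : ∀ j, j ≤ n + 1 → ∑ i ∈ Finset.range j, ((μ i : ℝ) - ν i) ≤ 0 := by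
      refine nonpos_of_convex_of_pos (by simp) ?_ fun j hj => ?_
      · rw [Finset.sum_sub_distrib, sub_nonpos]
        exact_mod_cast h.2.ge
      · rcases mul_eq_zero.1 (hsum j (Finset.mem_range.2 (by omega))) with h1 | h1
        · exact Or.inl h1.le
        · right
          have h2 := hμ j hj (by linarith)
          have h3 : (ν (j + 1) : ℝ) ≤ ν j := by exact_mod_cast hν j hj
          rw [Finset.sum_range_succ _ (j + 1), Finset.sum_range_succ _ j, h2]
          linarith
    intro i hi
    have h1 := hD i (by omega)
    have h2 := hD (i + 1) (by omega)
    have h3 := h.partial_sum_nonneg (show i ≤ n + 1 by omega)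
    have h4 := h.partial_sum_nonneg (show i + 1 ≤ n + 1 by omega)
    rw [Finset.sum_range_succ] at h2 h4
    have : (ν i : ℝ) = μ i := by linarith
    exact_mod_cast this

/-- A finite sequence can be rearranged, within the blocks on which the antitone sequence `y` is
constant, so that it increases on each block. -/
theorem exists_rearrangement (n : ℕ) (κ : ℕ → ℕ) (hy : ∀ i, i + 1 < n → y (i + 1) ≤ y i) :
    ∃ L : ℕ → ℕ,
      (∀ j, ((Finset.range n).filter fun k => j < L k).card =
        ((Finset.range n).filter fun k => j < κ k).card) ∧
      ∑ i ∈ Finset.range n, (L i : ℝ) * y i = ∑ i ∈ Finset.range n, (κ i : ℝ) * y i ∧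
      (∀ i, i + 1 < n → y (i + 1) = y i → L i ≤ L (i + 1)) ∧ ∀ i, i < n → ∃ j, L i = κ j := by
  let g : Fin n → ℝᵒᵈ ×ₗ ℕ := fun i => toLex (OrderDual.toDual (y i), κ i)
  let σ := Tuple.sort g
  have hg : Monotone (g ∘ σ) := Tuple.monotone_sort g
  have hanti : Antitone fun i : Fin n => y i := by
    intro a b hab
    obtain ⟨d, hd⟩ := Nat.exists_eq_add_of_le (Fin.le_def.1 hab)
    have : ∀ d, (a : ℕ) + d < n → y (a + d) ≤ y a := by
      intro d
      induction d with
      | zero => exact fun _ => le_rfl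
      | succ d ih => exact fun h => (hy _ h).trans (ih (by omega))
    change y b ≤ y a
    rw [hd]
    exact this d (by omega)
  -- sorting by `y` first does not change `y`, which is already sorted
  have hyσ (i : Fin n) : y (σ i) = y i := by
    have h1 : Antitone ((fun i : Fin n => y i) ∘ σ) := by
      intro a b hab
      have h2 := hg hab
      rw [Prod.Lex.le_iff] at h2
      rcases h2 with h2 | h2
      · exact (OrderDual.toDual_lt_toDual.1 h2).le
      · exact (OrderDual.toDual.injective h2.1).ge
    exact congrFun (Tuple.unique_antitone (τ := 1) h1 hanti) i
  have hL (i : Fin n) : (if h : (i : ℕ) < n then κ (σ ⟨i, h⟩) else 0) = κ (σ i) := dif_pos i.2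
  refine ⟨fun i => if h : i < n then κ (σ ⟨i, h⟩) else 0, fun j => ?_, ?_, fun i hi he => ?_,
    fun i hi => ⟨_, dif_pos hi⟩⟩
  · rw [Finset.card_filter, Finset.card_filter, Finset.sum_range, Finset.sum_range]
    simp_rw [hL]
    exact Equiv.sum_comp σ fun i : Fin n => if j < κ i then 1 else 0
  · rw [Finset.sum_range, Finset.sum_range]
    simp_rw [hL]
    rw [← Equiv.sum_comp σ fun i : Fin n => (κ i : ℝ) * y i]
    simp_rw [hyσ]
  · simp only [dif_pos hi, dif_pos (show i < n by omega)]
    have h2 := hg (show (⟨i, by omega⟩ : Fin n) ≤ ⟨i + 1, hi⟩ by simp)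
    rw [Prod.Lex.le_iff] at h2
    rcases h2 with h2 | h2
    · have h3 := OrderDual.toDual_lt_toDual.1 h2
      rw [hyσ, hyσ] at h3
      simp only at h3
      linarith
    · exact h2.2

end Dominance

/-! ### Values of tropical characters on Schur polynomials -/

/-- The properties of `f μ = ψ (s_μ)`, for a homomorphism `ψ` to the tropical reals with trivial
kernel, that come from the Littlewood-Richardson rule: `f μ + f κ` is the maximum of `f ν` over
the Schur polynomials `s_ν` that occur in `s_μ * s_κ`. -/
structure IsSchurWeight (n : ℕ) (f : YoungDiagram → ℝ) : Prop where
  bot : f ⊥ = 0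
  le_of_good : ∀ μ κ ν : YoungDiagram, μ.colLen 0 ≤ n → κ.colLen 0 ≤ n → ν.colLen 0 ≤ n →
    ∀ T : BoundedTableau n κ, Good n μ.rowLen T.1 →
      (∀ k, k < n → ν.rowLen k = μ.rowLen k + content T.1 k) → f ν ≤ f μ + f κ
  exists_eq : ∀ μ κ : YoungDiagram, μ.colLen 0 ≤ n → κ.colLen 0 ≤ n →
    ∃ (ν : YoungDiagram) (T : BoundedTableau n κ), ν.colLen 0 ≤ n ∧
      (∀ k, k < n → ν.rowLen k = μ.rowLen k + content T.1 k) ∧ f ν = f μ + f κ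

/-- The `i`-th coordinate of the vector that defines a tropical character: the increment of its
values on the elementary symmetric polynomials. -/
def columnIncrement (f : YoungDiagram → ℝ) (i : ℕ) : ℝ := f (column (i + 1)) - f (column i)

namespace IsSchurWeight

variable {n : ℕ} {f : YoungDiagram → ℝ}

/-- If the Schur polynomials of shape `μ` and `κ` are multiplied, an extremal weight `L` of `κ`
contributes `μ + L` as soon as the key tableau with content `L` is good for `μ`. -/
theorem le_of_rearrangement (hf : IsSchurWeight n f) {μ κ ν : YoungDiagram}
    (hμ : μ.colLen 0 ≤ n) (hκ : κ.colLen 0 ≤ n) (hν : ν.colLen 0 ≤ n) {L : ℕ → ℕ}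
    (hL : ∀ j, ((Finset.range n).filter fun k => j < L k).card =
      ((Finset.range n).filter fun k => j < κ.rowLen k).card)
    (hgood : ∀ J k, k + 1 < n → μ.rowLen (k + 1) + (L (k + 1) - J) ≤ μ.rowLen k + (L k - J))
    (hsum : ∀ k, k < n → ν.rowLen k = μ.rowLen k + L k) : f ν ≤ f μ + f κ := by
  refine hf.le_of_good μ κ ν hμ hκ hν
    ⟨keyTableau hκ hL, fun i j h => (keyTableau_mem h).1⟩ ?_ fun k hk => ?_
  · rintro J k ⟨hk, h⟩
    rw [rightContent_keyTableau hk, rightContent_keyTableau (by omega)] at h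
    have := hgood J k hk
    omega
  · rw [hsum k hk, content_keyTableau hk]

theorem le_add (hf : IsSchurWeight n f) {μ κ ν : YoungDiagram}
    (hμ : μ.colLen 0 ≤ n) (hκ : κ.colLen 0 ≤ n) (hν : ν.colLen 0 ≤ n)
    (hsum : ∀ k, k < n → ν.rowLen k = μ.rowLen k + κ.rowLen k) : f ν ≤ f μ + f κ := by
  refine hf.le_of_rearrangement hμ hκ hν (fun _ => rfl) (fun J k _ => ?_) hsum
  have := μ.rowLen_anti k (k + 1) (by omega)
  have := κ.rowLen_anti k (k + 1) (by omega)
  omega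

theorem column_zero (hf : IsSchurWeight n f) : f (column 0) = 0 := by
  rw [← hf.bot]
  congr 1

theorem sum_columnIncrement (hf : IsSchurWeight n f) (h : ℕ) :
    ∑ i ∈ Finset.range h, columnIncrement f i = f (column h) := by
  unfold columnIncrement
  rw [Finset.sum_range_sub fun i => f (column i), hf.column_zero, sub_zero]

theorem sum_column_mul (hf : IsSchurWeight n f) {h : ℕ} (hh : h ≤ n) :
    ∑ i ∈ Finset.range n, ((column h).rowLen i : ℝ) * columnIncrement f i = f (column h) := by
  rw [← hf.sum_columnIncrement h, ← Finset.sum_subset (Finset.range_subset_range.2 hh)]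
  · refine Finset.sum_congr rfl fun i hi => ?_
    rw [rowLen_column, if_pos (Finset.mem_range.1 hi), Nat.cast_one, one_mul]
  · intro i _ hi
    rw [rowLen_column, if_neg (by simpa using hi), Nat.cast_zero, zero_mul]

/-- The sequence `f (column k)` is concave: every Schur polynomial that occurs in
`e_(k + 2) * e_k` occurs in `e_(k + 1) ^ 2` too. -/
theorem columnIncrement_succ_le (hf : IsSchurWeight n f) (k : ℕ) (hk : k + 1 < n) :
    columnIncrement f (k + 1) ≤ columnIncrement f k := by
  have hc (h : ℕ) (hh : h ≤ n) : (column h).colLen 0 ≤ n := (colLen_column h).trans hh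
  obtain ⟨ν, T, hν, hT, heq⟩ := hf.exists_eq (column (k + 2)) (column k) (hc _ (by omega))
    (hc _ (by omega))
  have hT1 (i : ℕ) : content T.1 i ≤ 1 := content_column_le_one T.1 i
  have hsumcol (h : ℕ) (hh : h ≤ n) : ∑ i ∈ Finset.range n, (column h).rowLen i = h := by
    simp_rw [rowLen_column]
    rw [← Finset.sum_filter, Finset.sum_const, smul_eq_mul, mul_one]
    trans (Finset.range h).card
    · congr 1
      ext i
      simp only [Finset.mem_filter, Finset.mem_range]
      omega
    · exact Finset.card_range h
  have hsumT : ∑ i ∈ Finset.range n, content T.1 i = k := by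
    rw [sum_content_eq (hc k (by omega)), hsumcol k (by omega)]
  -- otherwise the first `k + 2` rows of `ν` have length 2, but `T` has only `k` cells
  have hT0 : content T.1 (k + 1) = 0 := by
    by_contra hne
    have h1 : ∀ i ∈ Finset.range (k + 2), content T.1 i = 1 := by
      intro i hi
      rw [Finset.mem_range] at hi
      have h2 := ν.rowLen_anti i (k + 1) (by omega)
      rw [hT i (by omega), hT (k + 1) hk, rowLen_column, rowLen_column, if_pos (by omega),
        if_pos (by omega)] at h2
      have := hT1 i
      omega
    have h2 := Finset.sum_le_sum_of_subset (f := content T.1)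
      (Finset.range_subset_range.2 (show k + 2 ≤ n by omega))
    rw [hsumT, Finset.sum_congr rfl h1, Finset.sum_const, Finset.card_range] at h2
    simp at h2
  have hLT (i : ℕ) (hi : i < n) : ν.rowLen i = (column (k + 1)).rowLen i +
      (content T.1 i + if i = k + 1 then 1 else 0) := by
    rw [hT i hi, rowLen_column, rowLen_column]
    split_ifs <;> omega
  have hL1 (i : ℕ) : (content T.1 i + if i = k + 1 then 1 else 0) ≤ 1 := by
    have := hT1 i
    split_ifs with h
    · rw [h, hT0]
    · omega
  have hcard (g : ℕ → ℕ) (hg : ∀ i, g i ≤ 1) (j : ℕ) :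
      ((Finset.range n).filter fun i => j < g i).card =
        if j = 0 then ∑ i ∈ Finset.range n, g i else 0 := by
    rw [Finset.card_filter]
    split_ifs with hj
    · refine Finset.sum_congr rfl fun i _ => ?_
      have := hg i
      split_ifs <;> omega
    · refine Finset.sum_eq_zero fun i _ => ?_
      have := hg i
      rw [if_neg (by omega)]
  -- so one cell of the first column of `ν` can be moved to the other factor, which makes both
  -- factors columns of length `k + 1`
  have key : f ν ≤ f (column (k + 1)) + f (column (k + 1)) := by
    refine hf.le_of_rearrangement (hc _ hk.le) (hc _ hk.le) hν
      (L := fun i => content T.1 i + if i = k + 1 then 1 else 0) (fun j => ?_)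
      (fun J i hi => ?_) hLT
    · rw [hcard _ hL1, hcard, hsumcol _ hk.le, Finset.sum_add_distrib, hsumT,
        Finset.sum_ite_eq', if_pos (Finset.mem_range.2 hk)]
      intro i
      rw [rowLen_column]
      split_ifs <;> omega
    · have h1 := ν.rowLen_anti i (i + 1) (by omega)
      rw [hLT i (by omega), hLT (i + 1) hi] at h1
      have h2 := (column (k + 1)).rowLen_anti i (i + 1) (by omega)
      have h3 := hL1 i
      have h4 := hL1 (i + 1)
      rcases Nat.eq_zero_or_pos J with hJ | hJ <;> omega
  unfold columnIncrement
  linarith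

theorem sum_add_mul {μ κ ν : ℕ → ℕ} (h : ∀ i, ν i = μ i + κ i) (y : ℕ → ℝ) :
    ∑ i ∈ Finset.range n, (ν i : ℝ) * y i =
      ∑ i ∈ Finset.range n, (μ i : ℝ) * y i + ∑ i ∈ Finset.range n, (κ i : ℝ) * y i := by
  rw [← Finset.sum_add_distrib]
  refine Finset.sum_congr rfl fun i _ => ?_
  rw [h, Nat.cast_add, add_mul]

theorem sum_bot_mul (y : ℕ → ℝ) :
    ∑ i ∈ Finset.range n, ((⊥ : YoungDiagram).rowLen i : ℝ) * y i = 0 := by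
  refine Finset.sum_eq_zero fun i _ => ?_
  have : (⊥ : YoungDiagram).rowLen i = 0 := by
    by_contra h
    exact YoungDiagram.notMem_bot _
      (YoungDiagram.mem_iff_lt_rowLen.2 (Nat.pos_of_ne_zero h))
  rw [this, Nat.cast_zero, zero_mul]

/-- A Schur polynomial occurs in the product of the elementary symmetric polynomials given by the
columns of its shape. -/
theorem le_sum (hf : IsSchurWeight n f) (μ : YoungDiagram) (hμ : μ.colLen 0 ≤ n) :
    f μ ≤ ∑ i ∈ Finset.range n, (μ.rowLen i : ℝ) * columnIncrement f i := by
  refine column_induction (P := fun μ => f μ ≤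
    ∑ i ∈ Finset.range n, (μ.rowLen i : ℝ) * columnIncrement f i) ?_ ?_ μ hμ
  · rw [hf.bot, sum_bot_mul]
  · intro μ ν h hμ hν hh ih hadd
    have h1 := hf.le_add hμ ((colLen_column h).trans hh) hν fun k _ => hadd k
    rw [sum_add_mul hadd, hf.sum_column_mul hh]
    linarith

/-- The product of elementary symmetric polynomials given by the columns of `μ` has the value
`∑ i, μ i * y i`, which is attained by a Schur polynomial that occurs in it. -/
theorem exists_dominated (hf : IsSchurWeight n f) (μ : YoungDiagram) (hμ : μ.colLen 0 ≤ n) :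
    ∃ ν : YoungDiagram, ν.colLen 0 ≤ n ∧ Dominated n ν.rowLen μ.rowLen ∧
      f ν = ∑ i ∈ Finset.range n, (μ.rowLen i : ℝ) * columnIncrement f i := by
  refine column_induction (P := fun μ => ∃ ν : YoungDiagram, ν.colLen 0 ≤ n ∧
    Dominated n ν.rowLen μ.rowLen ∧
      f ν = ∑ i ∈ Finset.range n, (μ.rowLen i : ℝ) * columnIncrement f i) ?_ ?_ μ hμ
  · refine ⟨⊥, ?_, Dominated.refl _ _, ?_⟩
    · rw [Nat.le_iff_lt_add_one]
      by_contra h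
      exact YoungDiagram.notMem_bot (n, 0) (YoungDiagram.mem_iff_lt_colLen.2 (by omega))
    · rw [hf.bot, sum_bot_mul]
  · rintro μ μ' h hμ hμ' hh ⟨ν, hν, hdom, heq⟩ hadd
    have hc : (column h).colLen 0 ≤ n := (colLen_column h).trans hh
    obtain ⟨ν', T, hν', hT, heq'⟩ := hf.exists_eq ν (column h) hν hc
    refine ⟨ν', hν', ?_, ?_⟩
    · exact (hdom.add (dominated_content hc T)).congr hT fun i _ => hadd i
    · rw [heq', heq, sum_add_mul hadd, hf.sum_column_mul hh]

/-- A shape that is constant wherever the increments are equal is the only one that can attain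
the value of its product of elementary symmetric polynomials. -/
theorem eq_sum_of_constant (hf : IsSchurWeight n f) (μ : YoungDiagram) (hμ : μ.colLen 0 ≤ n)
    (hconst : ∀ i, i + 1 < n → columnIncrement f (i + 1) = columnIncrement f i →
      μ.rowLen (i + 1) = μ.rowLen i) :
    f μ = ∑ i ∈ Finset.range n, (μ.rowLen i : ℝ) * columnIncrement f i := by
  obtain ⟨ν, hν, hdom, heq⟩ := hf.exists_dominated μ hμ
  have h1 := hf.le_sum ν hν
  have h2 := hdom.sum_mul_le hf.columnIncrement_succ_le
  have h3 : ν = μ := youngDiagram_ext_rowLen hν hμ <|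
    hdom.eq_of_sum_mul_eq hf.columnIncrement_succ_le
      (fun i _ => ν.rowLen_anti i (i + 1) (by omega)) hconst (by linarith)
  rw [← heq, h3]

/-- A weight is linear on the cone of partitions. For the lower bound, let `L` be the rearrangement
of `κ` that increases on the blocks of `y`, and let `C` be constant on these blocks, with large
drops between them. Then `s_C` occurs in `s_(C - L) * s_κ`, the value of `s_C` is known because `C`
is constant on blocks, and that of `s_(C - L)` is bounded from above. -/
theorem eq_sum (hf : IsSchurWeight n f) (κ : YoungDiagram) (hκ : κ.colLen 0 ≤ n) :
    f κ = ∑ i ∈ Finset.range n, (κ.rowLen i : ℝ) * columnIncrement f i := by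
  classical
  refine le_antisymm (hf.le_sum κ hκ) ?_
  set y := columnIncrement f with hy
  have hanti := hf.columnIncrement_succ_le
  rw [← hy] at hanti
  obtain ⟨L, hL, hLsum, hLmono, hLle⟩ := exists_rearrangement n κ.rowLen hanti
  have hLM (i : ℕ) (hi : i < n) : L i ≤ κ.rowLen 0 := by
    obtain ⟨j, hj⟩ := hLle i hi
    rw [hj]
    exact κ.rowLen_anti 0 j (Nat.zero_le j)
  -- `C` is constant on the blocks of `y`, and drops by at least the length of `κ` between them
  let C : ℕ → ℕ := fun i => κ.rowLen 0 *
    (1 + ((Finset.range n).filter fun j => i ≤ j ∧ j + 1 < n ∧ y (j + 1) < y j).card)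
  have hC1 (i : ℕ) (hi : i + 1 < n) (h : y (i + 1) = y i) : C (i + 1) = C i := by
    simp only [C]
    congr 3
    ext j
    simp only [Finset.mem_filter, and_congr_right_iff]
    intro _
    constructor
    · rintro ⟨h1, h2⟩
      exact ⟨by omega, h2⟩
    · rintro ⟨h1, h2, h3⟩
      refine ⟨?_, h2, h3⟩
      rcases Nat.eq_or_lt_of_le h1 with rfl | h4
      · exact absurd h h3.ne
      · omega
  have hC2 (i : ℕ) (hi : i + 1 < n) (h : y (i + 1) < y i) : C (i + 1) + κ.rowLen 0 ≤ C i := by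
    have h1 : ((Finset.range n).filter fun j => i + 1 ≤ j ∧ j + 1 < n ∧ y (j + 1) < y j).card <
        ((Finset.range n).filter fun j => i ≤ j ∧ j + 1 < n ∧ y (j + 1) < y j).card := by
      refine Finset.card_lt_card (Finset.ssubset_iff_of_subset ?_ |>.2 ⟨i, ?_, ?_⟩)
      · refine Finset.monotone_filter_right _ fun j _ hj => ⟨by omega, hj.2⟩
      · simp only [Finset.mem_filter, Finset.mem_range]
        exact ⟨by omega, le_rfl, hi, h⟩
      · simp
    simp only [C]
    rw [← Nat.mul_succ]
    exact Nat.mul_le_mul_left _ (by omega)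
  have hC3 (i : ℕ) : κ.rowLen 0 ≤ C i := Nat.le_mul_of_pos_right _ (by omega)
  have hstep (i : ℕ) (hi : i + 1 < n) :
      (C (i + 1) = C i ∧ L i ≤ L (i + 1)) ∨ C (i + 1) + κ.rowLen 0 ≤ C i := by
    rcases (hanti i hi).eq_or_lt with h | h
    · exact Or.inl ⟨hC1 i hi h, hLmono i hi h⟩
    · exact Or.inr (hC2 i hi h)
  have hCanti (i : ℕ) (hi : i + 1 < n) : C (i + 1) ≤ C i := by
    rcases hstep i hi with h | h <;> omega
  have hκanti (i : ℕ) (hi : i + 1 < n) : C (i + 1) - L (i + 1) ≤ C i - L i := by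
    have := hLM i (by omega)
    rcases hstep i hi with h | h <;> omega
  let μ := diagramOf n (fun i => C i - L i) hκanti
  let ν := diagramOf n C hCanti
  have hμr (i : ℕ) (hi : i < n) : μ.rowLen i = C i - L i := rowLen_diagramOf hi
  have hνr (i : ℕ) (hi : i < n) : ν.rowLen i = C i := rowLen_diagramOf hi
  have h1 : f ν ≤ f μ + f κ := by
    refine hf.le_of_rearrangement colLen_diagramOf hκ colLen_diagramOf hL (fun J i hi => ?_)
      fun i hi => ?_
    · rw [hμr i (by omega), hμr (i + 1) hi]
      have := hLM i (by omega)
      have := hLM (i + 1) hi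
      have := hC3 i
      have := hC3 (i + 1)
      rcases hstep i hi with h | h <;> omega
    · rw [hμr i hi, hνr i hi]
      have := hLM i hi
      have := hC3 i
      omega
  have h2 := hf.le_sum μ colLen_diagramOf
  have h3 := hf.eq_sum_of_constant ν colLen_diagramOf fun i hi h => by
    rw [hνr i (by omega), hνr (i + 1) hi, hC1 i hi h]
  have h4 : ∑ i ∈ Finset.range n, (ν.rowLen i : ℝ) * y i =
      ∑ i ∈ Finset.range n, (μ.rowLen i : ℝ) * y i + ∑ i ∈ Finset.range n, (L i : ℝ) * y i := by
    rw [← Finset.sum_add_distrib]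
    refine Finset.sum_congr rfl fun i hi => ?_
    rw [Finset.mem_range] at hi
    have := hLM i hi
    have := hC3 i
    rw [hνr i hi, hμr i hi, Nat.cast_sub (by omega)]
    ring
  rw [← hy] at h2 h3
  linarith

end IsSchurWeight

/-! ### Characters of the semiring of Schur positive polynomials -/

section Character

variable {n : ℕ}

/-- The Schur polynomial of a diagram with at most `n` rows, as an element of `schurSemiring n`. -/
noncomputable def schurElement {μ : YoungDiagram} (hμ : μ.colLen 0 ≤ n) : schurSemiring n :=
  ⟨schurPoly n μ, AddSubmonoid.subset_closure ⟨μ, hμ, rfl⟩⟩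

theorem schurElement_ne_zero {μ : YoungDiagram} (hμ : μ.colLen 0 ≤ n) : schurElement hμ ≠ 0 := by
  intro h
  have h0 : schurPoly n μ = 0 := congrArg Subtype.val h
  have h1 : Finsupp.equivFunOnFinite.symm
      (fun k : Fin n => content (boundedHighestWeight hμ).1 k) ∈ (schurPoly n μ).support :=
    mem_support_schurPoly.2 ⟨boundedHighestWeight hμ, fun _ => rfl⟩
  rw [h0, support_zero] at h1
  exact Finset.notMem_empty _ h1

/-- The shape `μ + content T` of the Schur polynomial that a good tableau `T` contributes to a
product in the Littlewood-Richardson rule. -/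
def goodShape {μ κ : YoungDiagram} (T : {T : BoundedTableau n κ // Good n μ.rowLen T.1}) :
    YoungDiagram :=
  diagramOf n (fun k => μ.rowLen k + content T.1.1 k) T.2.antitone

theorem colLen_goodShape {μ κ : YoungDiagram}
    (T : {T : BoundedTableau n κ // Good n μ.rowLen T.1}) : (goodShape T).colLen 0 ≤ n :=
  colLen_diagramOf

theorem rowLen_goodShape {μ κ : YoungDiagram}
    (T : {T : BoundedTableau n κ // Good n μ.rowLen T.1}) {k : ℕ} (hk : k < n) :
    (goodShape T).rowLen k = μ.rowLen k + content T.1.1 k :=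
  rowLen_diagramOf hk

theorem schurElement_mul {μ κ : YoungDiagram} (hμ : μ.colLen 0 ≤ n) (hκ : κ.colLen 0 ≤ n) :
    open Classical in schurElement hμ * schurElement hκ =
      ∑ T : {T : BoundedTableau n κ // Good n μ.rowLen T.1},
        schurElement (colLen_goodShape T) := by
  classical
  apply Subtype.ext
  rw [AddSubmonoidClass.coe_finsetSum]
  exact schurPoly_mul_schurPoly n μ κ hμ

/-- Two homomorphisms that agree on the Schur polynomials agree. -/
theorem eq_of_eq_schurElement (ψ φ : schurSemiring n →+*o TropicalReal)
    (h : ∀ (μ : YoungDiagram) (hμ : μ.colLen 0 ≤ n),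
      ψ (schurElement hμ) = φ (schurElement hμ)) (p : schurSemiring n) : ψ p = φ p := by
  obtain ⟨p, hp⟩ := p
  have hp' : p ∈ AddSubmonoid.closure (schurSet n) := hp
  induction hp' using AddSubmonoid.closure_induction with
  | mem x hx =>
    obtain ⟨μ, hμ, rfl⟩ := hx
    exact h μ hμ
  | zero => exact (map_zero ψ).trans (map_zero φ).symm
  | add x y hx hy h1 h2 =>
    have hψ := map_add ψ (⟨x, hx⟩ : schurSemiring n) ⟨y, hy⟩
    have hφ := map_add φ (⟨x, hx⟩ : schurSemiring n) ⟨y, hy⟩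
    rw [h1 hx, h2 hy] at hψ
    exact hψ.trans hφ.symm

/-- The values of a homomorphism with trivial kernel on the Schur polynomials form a weight. -/
theorem exists_isSchurWeight (ψ : schurSemiring n →+*o TropicalReal)
    (hψ : ∀ p, ψ p = 0 → p = 0) :
    ∃ f : YoungDiagram → ℝ, IsSchurWeight n f ∧
      ∀ (μ : YoungDiagram) (hμ : μ.colLen 0 ≤ n), ψ (schurElement hμ) = ofReal (f μ) := by
  classical
  have h1 (μ : YoungDiagram) : ∃ r : ℝ, ∀ hμ : μ.colLen 0 ≤ n,
      ψ (schurElement hμ) = ofReal r := by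
    by_cases hμ : μ.colLen 0 ≤ n
    · obtain ⟨r, hr⟩ := exists_eq_ofReal fun h => schurElement_ne_zero hμ (hψ _ h)
      exact ⟨r, fun _ => hr⟩
    · exact ⟨0, fun h => absurd h hμ⟩
  choose f hf using h1
  have hmul {μ κ : YoungDiagram} (hμ : μ.colLen 0 ≤ n) (hκ : κ.colLen 0 ≤ n) :
      ofReal (f μ + f κ) =
        Finset.univ.sup fun T : {T : BoundedTableau n κ // Good n μ.rowLen T.1} =>
          ofReal (f (goodShape T)) := by
    rw [← ofReal_mul, ← hf μ hμ, ← hf κ hκ, ← map_mul, schurElement_mul, map_sum, sum_eq_sup]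
    exact Finset.sup_congr rfl fun T _ => hf _ _
  refine ⟨f, ⟨?_, ?_, ?_⟩, hf⟩
  · have hbot : (⊥ : YoungDiagram).colLen 0 ≤ n := by
      by_contra h
      exact YoungDiagram.notMem_bot (n, 0) (YoungDiagram.mem_iff_lt_colLen.2 (by omega))
    apply ofReal_injective
    rw [← hf ⊥ hbot, show schurElement hbot = 1 from Subtype.ext (schurPoly_bot n), map_one]
    rfl
  · intro μ κ ν hμ hκ hν T hT hsum
    have h2 : ν = goodShape (⟨T, hT⟩ : {T : BoundedTableau n κ // Good n μ.rowLen T.1}) :=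
      youngDiagram_ext_rowLen hν (colLen_goodShape _) fun i hi => by
        rw [rowLen_goodShape _ hi, hsum i hi]
    rw [← ofReal_le, hmul hμ hκ, h2]
    exact Finset.le_sup (f := fun T : {T : BoundedTableau n κ // Good n μ.rowLen T.1} =>
      ofReal (f (goodShape T))) (Finset.mem_univ _)
  · intro μ κ hμ hκ
    have hne : (Finset.univ : Finset {T : BoundedTableau n κ // Good n μ.rowLen T.1}).Nonempty := by
      rw [Finset.nonempty_iff_ne_empty]
      intro he
      have h2 := hmul hμ hκ
      rw [he, Finset.sup_empty] at h2
      exact ofReal_ne_zero _ h2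
    obtain ⟨T, -, hT⟩ := Finset.exists_mem_eq_sup _ hne
      fun T : {T : BoundedTableau n κ // Good n μ.rowLen T.1} => ofReal (f (goodShape T))
    exact ⟨goodShape T, T.1, colLen_goodShape T, fun k hk => rowLen_goodShape T hk,
      ofReal_injective (hT.symm.trans (hmul hμ hκ).symm)⟩

/-- For antitone `y` the maximum over the support of a Schur polynomial is attained at the highest
weight, because the contents of all other tableaux are dominated by it. -/
theorem maxMonomial_schurPoly {y : ℕ → ℝ} (hy : ∀ i, i + 1 < n → y (i + 1) ≤ y i)
    {μ : YoungDiagram} (hμ : μ.colLen 0 ≤ n) :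
    maxMonomial (fun i : Fin n => y i) (schurPoly n μ) =
      ofReal (∑ i ∈ Finset.range n, (μ.rowLen i : ℝ) * y i) := by
  have hsum {α : Fin n →₀ ℕ} {T : BoundedTableau n μ} (h : ∀ k : Fin n, α k = content T.1 k) :
      ∑ i, (α i : ℝ) * y i = ∑ i ∈ Finset.range n, (content T.1 i : ℝ) * y i := by
    rw [Finset.sum_range]
    exact Finset.sum_congr rfl fun i _ => by rw [h]
  apply le_antisymm
  · refine Finset.sup_le fun α hα => ofReal_le.2 ?_
    obtain ⟨T, hT⟩ := mem_support_schurPoly.1 hα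
    rw [hsum hT]
    exact (dominated_content hμ T).sum_mul_le hy
  · have h1 : ∀ k : Fin n, Finsupp.equivFunOnFinite.symm
        (fun k : Fin n => content (boundedHighestWeight hμ).1 k) k =
          content (boundedHighestWeight hμ).1 k := fun _ => rfl
    have h2 := le_maxMonomial (fun i : Fin n => y i)
      (mem_support_schurPoly.2 ⟨boundedHighestWeight hμ, h1⟩)
    rw [hsum h1] at h2
    refine le_trans (le_of_eq ?_) h2
    congr 1
    refine Finset.sum_congr rfl fun i _ => ?_
    rw [boundedHighestWeight, content_highestWeight]

end Character

end SchurTrop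

theorem proposition3p3 (n : ℕ) :
    -- every `y ∈ ℝ^n` gives a monotone homomorphism with trivial kernel
    (∀ y : Fin n → ℝ, ∃ ψ : SchurTrop.schurSemiring n →+*o SchurTrop.TropicalReal,
      (∀ p, ψ p = 0 → p = 0) ∧
        ∀ p, ψ p = SchurTrop.maxMonomial y (p : MvPolynomial (Fin n) ℤ)) ∧
    -- every monotone homomorphism with trivial kernel arises in this way
    (∀ ψ : SchurTrop.schurSemiring n →+*o SchurTrop.TropicalReal, (∀ p, ψ p = 0 → p = 0) →
      ∃ y : Fin n → ℝ, ∀ p, ψ p = SchurTrop.maxMonomial y (p : MvPolynomial (Fin n) ℤ)) ∧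
    -- the value at `p ≠ 0` is the maximum of `⟨·, y⟩` over the Newton polytope of `p`
    (∀ (y : Fin n → ℝ) (p : SchurTrop.schurSemiring n), p ≠ 0 →
      IsGreatest
        ((fun v : Fin n → ℝ => SchurTrop.TropicalReal.ofReal (∑ i, v i * y i)) ''
          SchurTrop.newtonPolytope (p : MvPolynomial (Fin n) ℤ))
        (SchurTrop.maxMonomial y (p : MvPolynomial (Fin n) ℤ))) := by
  refine ⟨fun y => ⟨SchurTrop.maxMonomialHom y, fun p hp => ?_, fun p => rfl⟩, fun ψ hψ => ?_,
    fun y p hp => ?_⟩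
  · exact Subtype.ext ((SchurTrop.maxMonomial_eq_zero y).1 hp)
  · obtain ⟨f, hf, hval⟩ := SchurTrop.exists_isSchurWeight ψ hψ
    refine ⟨fun i => SchurTrop.columnIncrement f i, fun p => ?_⟩
    refine SchurTrop.eq_of_eq_schurElement ψ (SchurTrop.maxMonomialHom _) (fun μ hμ => ?_) p
    rw [hval μ hμ, hf.eq_sum μ hμ]
    exact (SchurTrop.maxMonomial_schurPoly hf.columnIncrement_succ_le hμ).symm
  · exact SchurTrop.isGreatest_maxMonomial y fun h => hp (Subtype.ext h)
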